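/- Let $\boldsymbol p_1,\boldsymbol p_2,\boldsymbol p_3\in\mathbb R^3$ be affinely independent, let $T$ be the closed triangle with these nodes (indices are cyclic modulo $3$), and let $\boldsymbol q,\boldsymbol r_0\in\mathbb R^3$. Assume that $\boldsymbol r_0\notin T$ and that $\boldsymbol r_0$ lies on none of the three lines containing the sides of $T$. Put $\boldsymbol R=\boldsymbol r-\boldsymbol r_0$, $R=|\boldsymbol R|$ and $f(\boldsymbol r)=\boldsymbol q\cdot\boldsymbol R\,R^{-3}$. **Notation.** Let $\boldsymbol s_i=\boldsymbol p_{i-1}-\boldsymbol p_{i+1}$, $s_i=|\boldsymbol s_i|$, $\hat{\boldsymbol s}_i=\boldsymbol s_i/s_i$; $\hat{\boldsymbol w}=(\hat{\boldsymbol s}_1\times\hat{\boldsymbol s}_2)/|\hat{\boldsymbol s}_1\times\hat{\boldsymbol s}_2|$, $\hat{\boldsymbol u}=\hat{\boldsymbol s}_3$, $\hat{\boldsymbol v}=\hat{\boldsymbol w}\times\hat{\boldsymbol u}$, $\hat{\boldsymbol m}_i=\hat{\boldsymbol s}_i\times\hat{\boldsymbol w}$; $u_3=-\boldsymbol s_2\cdot\hat{\boldsymbol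 u}$, $v_3=-\boldsymbol s_2\cdot\hat{\boldsymbol v}$. The unit normal of $T$ is $\hat{\boldsymbol n}=\hat{\boldsymbol w}$. Write $\boldsymbol r_0=\boldsymbol\rho-w_0\hat{\boldsymbol w}$ with $\boldsymbol\rho=\boldsymbol p_1+u_0\hat{\boldsymbol u}+v_0\hat{\boldsymbol v}$, and for $\boldsymbol r\in T$ let $u_a=(\boldsymbol r-\boldsymbol\rho)\cdot\hat{\boldsymbol u}$, $v_a=(\boldsymbol r-\boldsymbol\rho)\cdot\hat{\boldsymbol v}$. For $i=1,2,3$ let $$t_i^0=(\boldsymbol p_{i+1}-\boldsymbol\rho)\cdot\hat{\boldsymbol m}_i,\quad \boldsymbol t_i^0=t_i^0\hat{\boldsymbol m}_i,\quad s_i^-=(\boldsymbol p_{i+1}-\boldsymbol\rho)\cdot\hat{\boldsymbol s}_i,\quad s_i^+=(\boldsymbol p_{i-1}-\boldsymbol\rho)\cdot\hat{\boldsymbol s}_i,$$ $$R_i^0=\sqrt{(t_i^0)^2+w_0^2},\qquad R_i^\pm=\sqrt{(s_i^\pm)^2+(t_i^0)^2+w_0^2},$$ $$f_{2i}=\ln\frac{R_i^++s_i^+}{R_i^-+s_i^-},\qquad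 R_i^s=\frac1{(R_i^0)^2}\Big(\frac{s_i^+}{R_i^+}-\frac{s_i^-}{R_i^-}\Big),\qquad R_i^d=\frac1{R_i^-}-\frac1{R_i^+},$$ $$\beta=\sum_{i=1}^3\Big(\arctan\frac{t_i^0s_i^+}{(R_i^0)^2+|w_0|R_i^+}-\arctan\frac{t_i^0s_i^-}{(R_i^0)^2+|w_0|R_i^-}\Big),$$ and let $\operatorname{sgn}$ be the sign function, with $\operatorname{sgn}(0)=0$. Define, by integration with respect to surface area, $$I_0=\int_T\hat{\boldsymbol n}\cdot\nabla f\,dT,\qquad \begin{Bmatrix}I_u^a\\ I_v^a\end{Bmatrix}=\int_T\begin{Bmatrix}u_a\\ v_a\end{Bmatrix}\hat{\boldsymbol n}\cdot\nabla f\,dT .$$ **Statement.** These integrals converge absolutely, and $$\begin{Bmatrix}I_u^a\\ I_v^a\end{Bmatrix}=\boldsymbol q\cdot\Bigg[w_0\sum_{i=1}^3\hat{\boldsymbol m}_i\begin{Bmatrix}\hat{\boldsymbol u}\\ \hat{\boldsymbol v}\end{Bmatrix}\cdot\big(\hat{\boldsymbol s}_iR_i^d+\boldsymbol t_i^0R_i^s\big)-\begin{Bmatrix}\hat{\boldsymbol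 u}\\ \hat{\boldsymbol v}\end{Bmatrix}\operatorname{sgn}(w_0)\,\beta+\hat{\boldsymbol w}\Big(\begin{Bmatrix}\hat{\boldsymbol u}\\ \hat{\boldsymbol v}\end{Bmatrix}\cdot\sum_{i=1}^3\hat{\boldsymbol m}_i\big(R_i^sw_0^2-f_{2i}\big)\Big)\Bigg],$$ where the upper, respectively lower, entries of the braces are taken throughout; moreover $$I_0=\boldsymbol q\cdot\sum_{i=1}^3R_i^s\big(w_0\hat{\boldsymbol m}_i-t_i^0\hat{\boldsymbol w}\big).$$ Consequently, for the linear basis functions, that is, for affine $\varphi_i:\mathbb R^3\to\mathbb R$ with $\varphi_i(\boldsymbol p_j)=\delta_{ij}$ $(i,j=1,2,3)$, the integrals defining the surface element source vector $\boldsymbol b^s=\frac1{4\pi}\int_T\boldsymbol\varphi\,\langle\nabla f,\hat{\boldsymbol n}\rangle\,dT$, $\boldsymbol\varphi=[\varphi_1,\varphi_2,\varphi_3]^T$, converge absolutely, and $$4\pi\,\boldsymbol b^s=I_0\begin{bmatrix}1&-s_3^{-1}&(u_3s_3^{-1}-1)v_3^{-1}\\0&s_3^{-1}&-u_3s_3^{-1}v_3^{-1}\\0&0&v_3^{-1}\end{bmatrix}\begin{bmatrix}1\\u_0\\v_0\end{bmatrix}+\begin{bmatrix}-s_3^{-1}&(u_3s_3^{-1}-1)v_3^{-1}\\s_3^{-1}&-u_3s_3^{-1}v_3^{-1}\\0&v_3^{-1}\end{bmatrix}\begin{bmatrix}I_u^a\\I_v^a\end{bmatrix}.$$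 -/

import Mathlib

open MeasureTheory
open scoped RealInnerProductSpace Gradient Matrix

noncomputable section

namespace SurfaceElement

/-- Physical space `ℝ³` with the Euclidean norm. -/
abbrev E3 : Type := EuclideanSpace ℝ (Fin 3)

/-- The vector product of `ℝ³`. -/
def cross (a b : E3) : E3 := WithLp.toLp 2 (a.ofLp ⨯₃ b.ofLp)

/-- `a / |a|`. -/
def unit (a : E3) : E3 := ‖a‖⁻¹ • a

/-! A triangle is given by its nodes `p : Fin 3 → E3`. The index `0, 1, 2` stands for `1, 2, 3`,
and `i - 1`, `i + 1` are taken cyclically (modulo 3), as they are in `Fin 3`. -/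

/-- The closed triangle `T` with nodes `p₁, p₂, p₃`. -/
def triangle (p : Fin 3 → E3) : Set E3 := convexHull ℝ (Set.range p)

/-- `s_i = p_{i-1} - p_{i+1}`, the side of the triangle opposite to `p_i`. -/
def side (p : Fin 3 → E3) (i : Fin 3) : E3 := p (i - 1) - p (i + 1)

/-- The length `s_i = |s_i|`. -/
def sideLen (p : Fin 3 → E3) (i : Fin 3) : ℝ := ‖side p i‖

/-- `ŝ_i`. -/
def sHat (p : Fin 3 → E3) (i : Fin 3) : E3 := unit (side p i)

/-- The unit normal `ŵ` of the triangle, in the direction of `ŝ₁ × ŝ₂`. -/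
def wHat (p : Fin 3 → E3) : E3 := unit (cross (sHat p 0) (sHat p 1))

/-- `û = ŝ₃`. -/
def uHat (p : Fin 3 → E3) : E3 := sHat p 2

/-- `v̂ = ŵ × û`. -/
def vHat (p : Fin 3 → E3) : E3 := cross (wHat p) (uHat p)

/-- `m̂_i = ŝ_i × ŵ`, the outward unit normal to the `i`-th side in the plane of the triangle. -/
def mHat (p : Fin 3 → E3) (i : Fin 3) : E3 := cross (sHat p i) (wHat p)

/-- `u₃ = - s₂ · û`: the local frame has its origin in `p₁`, and there `p₃ = [u₃, v₃]`. -/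
def u3 (p : Fin 3 → E3) : ℝ := -⟪side p 1, uHat p⟫

/-- `v₃ = - s₂ · v̂`. -/
def v3 (p : Fin 3 → E3) : ℝ := -⟪side p 1, vHat p⟫

/-! The point `r₀ = ρ - w₀ ŵ` is the position of the dipole, and `ρ = [u₀, v₀, 0]`. -/

def u0 (p : Fin 3 → E3) (r₀ : E3) : ℝ := ⟪r₀ - p 0, uHat p⟫

def v0 (p : Fin 3 → E3) (r₀ : E3) : ℝ := ⟪r₀ - p 0, vHat p⟫

def w0 (p : Fin 3 → E3) (r₀ : E3) : ℝ := -⟪r₀ - p 0, wHat p⟫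

/-- `ρ`, the projection of `r₀` onto the plane of the triangle. -/
def rho (p : Fin 3 → E3) (r₀ : E3) : E3 := p 0 + u0 p r₀ • uHat p + v0 p r₀ • vHat p

/-- The pair `{û, v̂}`. -/
def axis (p : Fin 3 → E3) : Fin 2 → E3 := ![uHat p, vHat p]

/-- The pair of coordinates `{u_a, v_a}` of `r` in the local frame translated to the origin `ρ`. -/
def coordA (p : Fin 3 → E3) (r₀ : E3) (k : Fin 2) (r : E3) : ℝ := ⟪axis p k, r - rho p r₀⟫

/-! The `i`-th side is parametrised from `p_{i+1}` to `p_{i-1}` as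
`ρ + t_i⁰ m̂_i + s ŝ_i`, `s ∈ [s_i⁻, s_i⁺]`. -/

/-- `t_i⁰`, the signed distance (along `m̂_i`) from `ρ` to the line of the `i`-th side. -/
def t0 (p : Fin 3 → E3) (r₀ : E3) (i : Fin 3) : ℝ := ⟪p (i + 1) - rho p r₀, mHat p i⟫

/-- `s_i⁻`, the parameter of `p_{i+1}`. -/
def sMinus (p : Fin 3 → E3) (r₀ : E3) (i : Fin 3) : ℝ := ⟪p (i + 1) - rho p r₀, sHat p i⟫

/-- `s_i⁺`, the parameter of `p_{i-1}`. -/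
def sPlus (p : Fin 3 → E3) (r₀ : E3) (i : Fin 3) : ℝ := ⟪p (i - 1) - rho p r₀, sHat p i⟫

/-- `R_i⁰`. -/
def R0 (p : Fin 3 → E3) (r₀ : E3) (i : Fin 3) : ℝ :=
  Real.sqrt (t0 p r₀ i ^ 2 + w0 p r₀ ^ 2)

/-- `R_i⁻`. -/
def RMinus (p : Fin 3 → E3) (r₀ : E3) (i : Fin 3) : ℝ :=
  Real.sqrt (sMinus p r₀ i ^ 2 + t0 p r₀ i ^ 2 + w0 p r₀ ^ 2)

/-- `R_i⁺`. -/
def RPlus (p : Fin 3 → E3) (r₀ : E3) (i : Fin 3) : ℝ :=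
  Real.sqrt (sPlus p r₀ i ^ 2 + t0 p r₀ i ^ 2 + w0 p r₀ ^ 2)

/-- `f_{2i}`. -/
def f2 (p : Fin 3 → E3) (r₀ : E3) (i : Fin 3) : ℝ :=
  Real.log ((RPlus p r₀ i + sPlus p r₀ i) / (RMinus p r₀ i + sMinus p r₀ i))

/-- `R_i^s`. -/
def Rs (p : Fin 3 → E3) (r₀ : E3) (i : Fin 3) : ℝ :=
  1 / R0 p r₀ i ^ 2 * (sPlus p r₀ i / RPlus p r₀ i - sMinus p r₀ i / RMinus p r₀ i)

/-- `R_i^d`. -/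
def Rd (p : Fin 3 → E3) (r₀ : E3) (i : Fin 3) : ℝ := (RMinus p r₀ i)⁻¹ - (RPlus p r₀ i)⁻¹

/-- `β = β₁ + β₂ + β₃`. -/
def beta (p : Fin 3 → E3) (r₀ : E3) : ℝ :=
  ∑ i, (Real.arctan (t0 p r₀ i * sPlus p r₀ i / (R0 p r₀ i ^ 2 + |w0 p r₀| * RPlus p r₀ i))
    - Real.arctan (t0 p r₀ i * sMinus p r₀ i / (R0 p r₀ i ^ 2 + |w0 p r₀| * RMinus p r₀ i)))

/-- `f(r) = q · R / R³` with `R = r - r₀`. -/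
def dipole (q r₀ : E3) (r : E3) : ℝ := ⟪q, r - r₀⟫ / ‖r - r₀‖ ^ 3

/-- `n̂ · ∇f(r)`, where the unit normal `n̂` of the triangle is `ŵ`. -/
def normalFlux (p : Fin 3 → E3) (q r₀ : E3) (r : E3) : ℝ := ⟪wHat p, ∇ (dipole q r₀) r⟫

/-- `I₀ = ∫_T n̂ · ∇f`, an integral with respect to surface area. -/
def I0 (p : Fin 3 → E3) (q r₀ : E3) : ℝ :=
  ∫ r in triangle p, normalFlux p q r₀ r ∂μHE[2]

/-- The pair `{I_u^a, I_v^a} = ∫_T {u_a, v_a} n̂ · ∇f`. -/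
def Ia (p : Fin 3 → E3) (q r₀ : E3) (k : Fin 2) : ℝ :=
  ∫ r in triangle p, coordA p r₀ k r * normalFlux p q r₀ r ∂μHE[2]

/-- The surface element source vector `b^s = (4π)⁻¹ ∫_T φ ⟨∇f, n̂⟩` of the functions `φ`. -/
def bs (p : Fin 3 → E3) (q r₀ : E3) (φ : Fin 3 → E3 → ℝ) (i : Fin 3) : ℝ :=
  1 / (4 * Real.pi) * ∫ r in triangle p, φ i r * normalFlux p q r₀ r ∂μHE[2]

/-- The matrix of the linear basis functions in the local frame, `φ(u, v) = Φ [1, u, v]ᵀ`. -/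
def basisMatrix (p : Fin 3 → E3) : Matrix (Fin 3) (Fin 3) ℝ :=
  !![1, -(sideLen p 2)⁻¹, (u3 p * (sideLen p 2)⁻¹ - 1) * (v3 p)⁻¹;
     0, (sideLen p 2)⁻¹, -(u3 p * (sideLen p 2)⁻¹ * (v3 p)⁻¹);
     0, 0, (v3 p)⁻¹]

/-- The last two columns of `basisMatrix`. -/
def basisMatrixLin (p : Fin 3 → E3) : Matrix (Fin 3) (Fin 2) ℝ :=
  !![-(sideLen p 2)⁻¹, (u3 p * (sideLen p 2)⁻¹ - 1) * (v3 p)⁻¹;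
     (sideLen p 2)⁻¹, -(u3 p * (sideLen p 2)⁻¹ * (v3 p)⁻¹);
     0, (v3 p)⁻¹]

end SurfaceElement

end

/-! On the plane of `T` the normal component of `R` is the constant `w₀`, and there the flux density
is a tangential divergence. Indeed `f = -q·∇(1/R)`. For the tangential part of `q`, the normal
derivative commutes with `q·∇` and `∂_w(1/R) = -w₀R⁻³`. For the normal part, harmonicity of `1/R`
trades `-∂_w²` for the tangential Laplacian. This gives `normalFlux_eq_divergence`.

Multiplying by `u_a` or `v_a` and using the product rule gives
`coordA_mul_normalFlux_eq_divergence`. The only term that is not yet a divergence is a multiple of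
`w₀R⁻³`, the solid angle density. With `R_t` the tangential part of `R`, the radial field
`R_t/(R(R+|w₀|))` has divergence `|w₀|R⁻³` (`abs_w0_mul_inv_cube_eq_divergence`). It has no
singularity at `ρ` when `w₀ ≠ 0`, so no correction is needed when `ρ` lies inside `T`.

The divergence theorem `integral_triangle_fderiv` then reduces everything to the sides. On a side
`R² = s² + (t_i⁰)² + w₀²`, so the remaining integrals in `s` have elementary primitives; they
produce `R_i^s`, `R_i^d`, `f_{2i}` and the arctangents of `β`. The source vector follows by writing
each basis function in the local coordinates (`affine_apply_of_mem`, `affine_moment`). -/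

namespace SurfaceElement

/-! ### The vector product -/

lemma inner_eq_sum (a b : E3) : ⟪a, b⟫ = a 0 * b 0 + a 1 * b 1 + a 2 * b 2 := by
  simp [PiLp.inner_apply, Fin.sum_univ_three, mul_comm]

lemma cross_apply_zero (a b : E3) : cross a b 0 = a 1 * b 2 - a 2 * b 1 := by
  simp [cross, cross_apply]

lemma cross_apply_one (a b : E3) : cross a b 1 = a 2 * b 0 - a 0 * b 2 := by
  simp [cross, cross_apply]

lemma cross_apply_two (a b : E3) : cross a b 2 = a 0 * b 1 - a 1 * b 0 := by
  simp [cross, cross_apply]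

lemma E3.ext {a b : E3} (h0 : a 0 = b 0) (h1 : a 1 = b 1) (h2 : a 2 = b 2) : a = b := by
  ext i; fin_cases i <;> assumption

lemma cross_smul_left (c : ℝ) (a b : E3) : cross (c • a) b = c • cross a b := by
  apply E3.ext <;> simp [cross_apply_zero, cross_apply_one, cross_apply_two] <;> ring

lemma cross_smul_right (c : ℝ) (a b : E3) : cross a (c • b) = c • cross a b := by
  apply E3.ext <;> simp [cross_apply_zero, cross_apply_one, cross_apply_two] <;> ring

lemma cross_sub_neg (a b : E3) : cross (b - a) (-b) = cross a b := by
  apply E3.ext <;> simp [cross_apply_zero, cross_apply_one, cross_apply_two] <;> ring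

lemma cross_antisymm (a b : E3) : cross a b = -cross b a := by
  apply E3.ext <;> simp [cross_apply_zero, cross_apply_one, cross_apply_two] <;> ring

lemma inner_cross_self_left (a b : E3) : ⟪a, cross a b⟫ = 0 := by
  simp only [inner_eq_sum, cross_apply_zero, cross_apply_one, cross_apply_two]; ring

lemma inner_cross_self_right (a b : E3) : ⟪b, cross a b⟫ = 0 := by
  simp only [inner_eq_sum, cross_apply_zero, cross_apply_one, cross_apply_two]; ring

lemma inner_cross_cyclic (a b c : E3) : ⟪a, cross b c⟫ = ⟪c, cross a b⟫ := by
  simp only [inner_eq_sum, cross_apply_zero, cross_apply_one, cross_apply_two]; ring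

lemma norm_cross_sq (a b : E3) : ‖cross a b‖ ^ 2 = ‖a‖ ^ 2 * ‖b‖ ^ 2 - ⟪a, b⟫ ^ 2 := by
  simp only [← real_inner_self_eq_norm_sq, inner_eq_sum, cross_apply_zero, cross_apply_one,
    cross_apply_two]
  ring

lemma norm_cross_of_inner_eq_zero {a b : E3} (h : ⟪a, b⟫ = 0) : ‖cross a b‖ = ‖a‖ * ‖b‖ := by
  rw [← sq_eq_sq₀ (norm_nonneg _) (by positivity), norm_cross_sq, h]; ring

lemma norm_unit {a : E3} (h : a ≠ 0) : ‖unit a‖ = 1 := by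
  simp [unit, norm_smul, h]

lemma norm_smul_unit {a : E3} (h : a ≠ 0) : ‖a‖ • unit a = a := by
  simp [unit, smul_smul, h]

lemma unit_smul_of_pos {c : ℝ} (hc : 0 < c) (a : E3) : unit (c • a) = unit a := by
  simp only [unit, norm_smul, Real.norm_eq_abs, abs_of_pos hc, smul_smul, mul_inv]
  congr 1
  field_simp

/-! ### The frame of the triangle -/

lemma side_zero (p : Fin 3 → E3) : side p 0 = p 2 - p 1 := rfl
lemma side_one (p : Fin 3 → E3) : side p 1 = p 0 - p 2 := rfl
lemma side_two (p : Fin 3 → E3) : side p 2 = p 1 - p 0 := rfl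

/-- The vector `(p₂ - p₁) × (p₃ - p₁)`, whose length is twice the area of the triangle. -/
noncomputable def areaVec (p : Fin 3 → E3) : E3 := cross (p 1 - p 0) (p 2 - p 0)

lemma areaVec_ne_zero {p : Fin 3 → E3} (hp : AffineIndependent ℝ p) : areaVec p ≠ 0 := by
  intro h
  have hl : LinearIndependent ℝ ![p 1 - p 0, p 2 - p 0] := by
    have h1 := (affineIndependent_iff_linearIndependent_vsub ℝ p 0).1 hp
    let f : Fin 2 → {x : Fin 3 // x ≠ 0} := fun i => ⟨i.succ, Fin.succ_ne_zero i⟩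
    have hf : Function.Injective f := fun i j hij => by
      simpa [f] using hij
    have h2 := h1.comp f hf
    have h3 : ![p 1 - p 0, p 2 - p 0] = (fun i : {x : Fin 3 // x ≠ 0} => p i -ᵥ p 0) ∘ f := by
      ext1 i
      fin_cases i <;> rfl
    rw [h3]
    exact h2
  rw [LinearIndependent.pair_iff] at hl
  have key := norm_cross_sq (p 1 - p 0) (p 2 - p 0)
  rw [← areaVec, h, norm_zero] at key
  set a := p 1 - p 0 with ha
  set b := p 2 - p 0 with hb
  -- Equality case of Cauchy–Schwarz: this squared norm equals `|b|²(|a|²|b|² - (a·b)²) = |b|²|a ×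
  -- b|²`, so a vanishing product forces a linear relation between the edges.
  have h3 : ‖(‖b‖ ^ 2) • a + (-⟪a, b⟫) • b‖ ^ 2 = 0 := by
    rw [norm_add_sq_real, norm_smul, norm_smul, inner_smul_left, inner_smul_right]
    simp only [norm_pow, norm_neg, Real.norm_eq_abs, mul_pow, sq_abs, conj_trivial]
    linear_combination (-‖b‖ ^ 2) * key
  have h4 := hl _ _ (norm_eq_zero.1 (pow_eq_zero_iff two_ne_zero |>.1 h3))
  have hb0 : b = 0 := by simpa using h4.1
  have := hl 0 1 (by simp [hb0])
  simp at this

lemma areaVec_eq_cross_side (p : Fin 3 → E3) : cross (side p 0) (side p 1) = areaVec p := by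
  rw [areaVec, ← cross_sub_neg (p 1 - p 0), side_zero, side_one, sub_sub_sub_cancel_right, neg_sub]

lemma side_ne_zero {p : Fin 3 → E3} (hp : AffineIndependent ℝ p) (i : Fin 3) : side p i ≠ 0 := by
  rw [side, sub_ne_zero]
  refine hp.injective.ne ?_
  fin_cases i <;> decide

lemma sideLen_pos {p : Fin 3 → E3} (hp : AffineIndependent ℝ p) (i : Fin 3) :
    0 < sideLen p i := norm_pos_iff.2 (side_ne_zero hp i)

lemma sideLen_smul_sHat {p : Fin 3 → E3} (hp : AffineIndependent ℝ p) (i : Fin 3) :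
    sideLen p i • sHat p i = side p i := norm_smul_unit (side_ne_zero hp i)

/-- `ŝ₁ × ŝ₂` is a positive multiple of `areaVec`. One vector therefore carries both the normal (its
direction) and the Jacobian of the parametrisation (its length). -/
lemma wHat_eq {p : Fin 3 → E3} (hp : AffineIndependent ℝ p) : wHat p = unit (areaVec p) := by
  have h0 := sideLen_pos hp 0
  have h1 := sideLen_pos hp 1
  have h : cross (sHat p 0) (sHat p 1)
      = ((sideLen p 0)⁻¹ * (sideLen p 1)⁻¹) • cross (side p 0) (side p 1) := by
    rw [← smul_smul, ← cross_smul_right, ← cross_smul_left]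
    rfl
  rw [wHat, ← areaVec_eq_cross_side, h]
  exact unit_smul_of_pos (mul_pos (inv_pos.2 h0) (inv_pos.2 h1)) _

lemma norm_wHat {p : Fin 3 → E3} (hp : AffineIndependent ℝ p) : ‖wHat p‖ = 1 := by
  rw [wHat_eq hp]; exact norm_unit (areaVec_ne_zero hp)

lemma norm_areaVec_smul_wHat {p : Fin 3 → E3} (hp : AffineIndependent ℝ p) :
    ‖areaVec p‖ • wHat p = areaVec p := by
  rw [wHat_eq hp]; exact norm_smul_unit (areaVec_ne_zero hp)

lemma norm_sHat {p : Fin 3 → E3} (hp : AffineIndependent ℝ p) (i : Fin 3) : ‖sHat p i‖ = 1 :=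
  norm_unit (side_ne_zero hp i)

lemma inner_sub_wHat {p : Fin 3 → E3} (hp : AffineIndependent ℝ p) (i : Fin 3) :
    ⟪p i - p 0, wHat p⟫ = 0 := by
  have h : ⟪p i - p 0, areaVec p⟫ = 0 := by
    fin_cases i
    · simp
    · exact inner_cross_self_left _ _
    · exact inner_cross_self_right _ _
  rw [← norm_areaVec_smul_wHat hp, inner_smul_right] at h
  exact (mul_eq_zero.1 h).resolve_left (norm_ne_zero_iff.2 (areaVec_ne_zero hp))

lemma inner_side_wHat {p : Fin 3 → E3} (hp : AffineIndependent ℝ p) (i : Fin 3) :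
    ⟪side p i, wHat p⟫ = 0 := by
  rw [side, ← sub_sub_sub_cancel_right _ _ (p 0), inner_sub_left, inner_sub_wHat hp,
    inner_sub_wHat hp, sub_zero]

lemma inner_sHat_wHat {p : Fin 3 → E3} (hp : AffineIndependent ℝ p) (i : Fin 3) :
    ⟪sHat p i, wHat p⟫ = 0 := by
  rw [sHat, unit, inner_smul_left, inner_side_wHat hp, mul_zero]

/-- Two perpendicular unit vectors and their vector product form an orthonormal basis. -/
lemma eq_sum_inner_smul {a w : E3} (ha : ‖a‖ = 1) (hw : ‖w‖ = 1) (h : ⟪a, w⟫ = 0) (x : E3) :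
    x = ⟪a, x⟫ • a + ⟪cross a w, x⟫ • cross a w + ⟪w, x⟫ • w := by
  have ho : Orthonormal ℝ ![a, cross a w, w] := by
    have hn : ‖cross a w‖ = 1 := by rw [norm_cross_of_inner_eq_zero h, ha, hw, one_mul]
    refine ⟨fun i => ?_, fun i j hij => ?_⟩
    · fin_cases i <;> simp [ha, hw, hn]
    · fin_cases i <;> fin_cases j <;>
        simp_all [inner_cross_self_left, inner_cross_self_right, real_inner_comm]
  let b := (basisOfOrthonormalOfCardEqFinrank ho (by simp)).toOrthonormalBasis (by simpa using ho)
  have := b.sum_repr' x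
  simpa [b, Fin.sum_univ_three] using this.symm

lemma uHat_inner_wHat {p : Fin 3 → E3} (hp : AffineIndependent ℝ p) :
    ⟪uHat p, wHat p⟫ = 0 := inner_sHat_wHat hp 2

lemma norm_uHat {p : Fin 3 → E3} (hp : AffineIndependent ℝ p) : ‖uHat p‖ = 1 := norm_sHat hp 2

lemma norm_vHat {p : Fin 3 → E3} (hp : AffineIndependent ℝ p) : ‖vHat p‖ = 1 := by
  rw [vHat, norm_cross_of_inner_eq_zero, norm_wHat hp, norm_uHat hp, one_mul]
  rw [real_inner_comm, uHat_inner_wHat hp]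

lemma vHat_inner_wHat (p : Fin 3 → E3) : ⟪vHat p, wHat p⟫ = 0 := by
  rw [real_inner_comm]; exact inner_cross_self_left _ _

lemma eq_sum_frame {p : Fin 3 → E3} (hp : AffineIndependent ℝ p) (x : E3) :
    x = ⟪uHat p, x⟫ • uHat p + ⟪vHat p, x⟫ • vHat p + ⟪wHat p, x⟫ • wHat p := by
  have := eq_sum_inner_smul (norm_uHat hp) (norm_wHat hp) (uHat_inner_wHat hp) x
  rw [cross_antisymm (uHat p), ← vHat] at this
  simpa using this

lemma inner_eq_sum_frame {p : Fin 3 → E3} (hp : AffineIndependent ℝ p) (x y : E3) :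
    ⟪x, y⟫ = ⟪uHat p, x⟫ * ⟪uHat p, y⟫ + ⟪vHat p, x⟫ * ⟪vHat p, y⟫
      + ⟪wHat p, x⟫ * ⟪wHat p, y⟫ := by
  conv_lhs => rw [eq_sum_frame hp x]
  simp only [inner_add_left, inner_smul_left, conj_trivial]

lemma inner_mHat_wHat (p : Fin 3 → E3) (i : Fin 3) : ⟪mHat p i, wHat p⟫ = 0 := by
  rw [real_inner_comm]; exact inner_cross_self_right _ _

lemma inner_mHat_sHat (p : Fin 3 → E3) (i : Fin 3) : ⟪mHat p i, sHat p i⟫ = 0 := by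
  rw [real_inner_comm]; exact inner_cross_self_left _ _

lemma norm_mHat {p : Fin 3 → E3} (hp : AffineIndependent ℝ p) (i : Fin 3) : ‖mHat p i‖ = 1 := by
  rw [mHat, norm_cross_of_inner_eq_zero (inner_sHat_wHat hp i), norm_sHat hp, norm_wHat hp, one_mul]

lemma eq_of_inner_wHat_eq_zero {p : Fin 3 → E3} (hp : AffineIndependent ℝ p) (i : Fin 3) {x : E3}
    (hx : ⟪x, wHat p⟫ = 0) : x = ⟪x, mHat p i⟫ • mHat p i + ⟪x, sHat p i⟫ • sHat p i := by
  have := eq_sum_inner_smul (norm_sHat hp i) (norm_wHat hp) (inner_sHat_wHat hp i) x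
  rw [← mHat, real_inner_comm _ (wHat p), hx, zero_smul, add_zero, add_comm] at this
  rwa [real_inner_comm, real_inner_comm x (sHat p i)] at this

/-- `s_i d · m̂_i` as a triple product. -/
lemma sideLen_mul_inner_mHat {p : Fin 3 → E3} (hp : AffineIndependent ℝ p) (i : Fin 3) (d : E3) :
    sideLen p i * ⟪d, mHat p i⟫ = ⟪wHat p, cross d (side p i)⟫ := by
  rw [mHat, ← inner_smul_right, ← cross_smul_left, sideLen_smul_sHat hp, inner_cross_cyclic]

lemma inner_wHat_areaVec {p : Fin 3 → E3} (hp : AffineIndependent ℝ p) :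
    ⟪wHat p, areaVec p⟫ = ‖areaVec p‖ := by
  conv_lhs => rw [← norm_areaVec_smul_wHat hp]
  rw [inner_smul_right, real_inner_self_eq_norm_sq, norm_wHat hp]; simp

lemma rho_sub (p : Fin 3 → E3) (hp : AffineIndependent ℝ p) (r₀ : E3) :
    rho p r₀ - r₀ = w0 p r₀ • wHat p := by
  have := eq_sum_frame hp (r₀ - p 0)
  rw [rho, u0, v0, w0, real_inner_comm (uHat p), real_inner_comm (vHat p),
    real_inner_comm (wHat p), neg_smul]
  linear_combination (norm := module) (-1 : ℝ) • this

lemma inner_rho_sub_wHat {p : Fin 3 → E3} (hp : AffineIndependent ℝ p) (r₀ : E3) :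
    ⟪rho p r₀ - p 0, wHat p⟫ = 0 := by
  rw [rho, add_assoc, add_sub_cancel_left, inner_add_left, inner_smul_left, inner_smul_left,
    uHat_inner_wHat hp, vHat_inner_wHat]
  simp

lemma R0_sq (p : Fin 3 → E3) (r₀ : E3) (i : Fin 3) :
    R0 p r₀ i ^ 2 = t0 p r₀ i ^ 2 + w0 p r₀ ^ 2 := Real.sq_sqrt (by positivity)

lemma node_sub_rho {p : Fin 3 → E3} (hp : AffineIndependent ℝ p) (r₀ : E3) (i : Fin 3) :
    p (i + 1) - rho p r₀ = t0 p r₀ i • mHat p i + sMinus p r₀ i • sHat p i := by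
  apply eq_of_inner_wHat_eq_zero hp
  rw [← sub_sub_sub_cancel_right _ _ (p 0), inner_sub_left, inner_sub_wHat hp,
    inner_rho_sub_wHat hp, sub_zero]

lemma sPlus_eq {p : Fin 3 → E3} (hp : AffineIndependent ℝ p) (r₀ : E3) (i : Fin 3) :
    sPlus p r₀ i = sMinus p r₀ i + sideLen p i := by
  rw [sPlus, sMinus, ← sub_eq_iff_eq_add', ← inner_sub_left, sub_sub_sub_cancel_right,
    ← side, ← sideLen_smul_sHat hp, inner_smul_left, real_inner_self_eq_norm_sq, norm_sHat hp]
  simp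

/-- If `t_i⁰` and `w₀` both vanish, then `r₀ = ρ` lies on the line of the side. Positivity is what
makes the primitives along the whole side smooth. -/
lemma R0_sq_pos {p : Fin 3 → E3} (hp : AffineIndependent ℝ p) {r₀ : E3} {i : Fin 3}
    (h : r₀ ∉ line[ℝ, p (i - 1), p (i + 1)]) : 0 < t0 p r₀ i ^ 2 + w0 p r₀ ^ 2 := by
  by_contra hn
  have ht : t0 p r₀ i = 0 := by nlinarith [sq_nonneg (t0 p r₀ i), sq_nonneg (w0 p r₀)]
  have hw : w0 p r₀ = 0 := by nlinarith [sq_nonneg (t0 p r₀ i), sq_nonneg (w0 p r₀)]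
  apply h
  have h1 := rho_sub p hp r₀
  have h2 := node_sub_rho hp r₀ i
  rw [hw, zero_smul, sub_eq_zero] at h1
  rw [ht, zero_smul, zero_add, h1] at h2
  rw [Set.pair_comm]
  -- From `p_{i+1} - r₀ = s_i⁻ ŝ_i`, the affine parameter of `r₀` along the side is `-s_i⁻/s_i`.
  have h3 : r₀ = AffineMap.lineMap (p (i + 1)) (p (i - 1))
      (-(sMinus p r₀ i * (sideLen p i)⁻¹)) := by
    rw [AffineMap.lineMap_apply, vsub_eq_sub, ← side, ← sideLen_smul_sHat hp, smul_smul,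
      neg_mul, mul_assoc, inv_mul_cancel₀ (sideLen_pos hp i).ne', mul_one, neg_smul, ← h2,
      vadd_eq_add]
    abel
  rw [h3]
  exact AffineMap.lineMap_mem_affineSpan_pair _ _ _

/-! ### Integration over the triangle -/

/-- The triangle with nodes `(0, 0)`, `(1, 0)`, `(0, 1)`. -/
def stdTriangle : Set (ℝ × ℝ) := {x | 0 ≤ x.1 ∧ 0 ≤ x.2 ∧ x.1 + x.2 ≤ 1}

/-- The affine parametrisation of a triangle. -/
noncomputable def triMap (p : Fin 3 → E3) (x : ℝ × ℝ) : E3 :=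
  p 0 + x.1 • (p 1 - p 0) + x.2 • (p 2 - p 0)

lemma continuous_triMap (p : Fin 3 → E3) : Continuous (triMap p) := by
  unfold triMap; fun_prop

lemma isCompact_stdTriangle : IsCompact stdTriangle := by
  refine (isCompact_Icc (a := ((0 : ℝ), (0 : ℝ))) (b := (1, 1))).of_isClosed_subset ?_ ?_
  · simp only [stdTriangle, Set.ofPred_and]
    exact (isClosed_le (by fun_prop) (by fun_prop)).inter
      ((isClosed_le (by fun_prop) (by fun_prop)).inter (isClosed_le (by fun_prop) (by fun_prop)))
  · rintro ⟨a, b⟩ ⟨ha, hb, hab⟩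
    simp only at ha hb hab
    exact ⟨⟨ha, hb⟩, ⟨by simp only; linarith, by simp only; linarith⟩⟩

lemma triangle_eq_image (p : Fin 3 → E3) : triangle p = triMap p '' stdTriangle := by
  rw [triangle, convexHull_range_eq_exists_affineCombination]
  ext x
  constructor
  · rintro ⟨s, w, hw0, hw1, rfl⟩
    -- Weights given on a subset of the nodes are extended by zero to all three.
    set w' : Fin 3 → ℝ := Set.indicator s w with hw'
    have h1 : ∑ i, w' i = 1 := by
      rw [← hw1, hw']
      exact (Finset.sum_indicator_subset w (Finset.subset_univ s))
    have h0 : ∀ i, 0 ≤ w' i := fun i => Set.indicator_nonneg (fun j hj => hw0 j hj) i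
    rw [Finset.affineCombination_indicator_subset w p (Finset.subset_univ s), ← hw',
      Finset.affineCombination_eq_linear_combination _ _ _ h1]
    rw [Fin.sum_univ_three] at h1
    refine ⟨(w' 1, w' 2), ⟨h0 1, h0 2, by simp only; linarith [h0 0]⟩, ?_⟩
    rw [triMap, Fin.sum_univ_three, show w' 0 = 1 - w' 1 - w' 2 by linarith]
    module
  · rintro ⟨⟨a, b⟩, ⟨ha, hb, hab⟩, rfl⟩
    simp only at ha hb hab
    refine ⟨Finset.univ, ![1 - a - b, a, b], ?_, ?_, ?_⟩
    · intro i _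
      fin_cases i <;> simp <;> linarith
    · simp [Fin.sum_univ_three]; ring
    · rw [Finset.affineCombination_eq_linear_combination _ _ _ (by simp [Fin.sum_univ_three]; ring),
        Fin.sum_univ_three, triMap]
      simp only [Matrix.cons_val]
      module

lemma triMap_mem {p : Fin 3 → E3} {x : ℝ × ℝ} (hx : x ∈ stdTriangle) :
    triMap p x ∈ triangle p := by
  rw [triangle_eq_image]; exact Set.mem_image_of_mem _ hx

lemma isCompact_triangle (p : Fin 3 → E3) : IsCompact (triangle p) := by
  rw [triangle_eq_image]; exact isCompact_stdTriangle.image (continuous_triMap p)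

/-- A linear map from the plane scales area by the square root of its Gram determinant, which is `|a
× b|` by Lagrange's identity; the translation by `p 0` is an isometry. -/
lemma euclideanHausdorffMeasure_triMap_image (p : Fin 3 → E3) (B : Set (ℝ × ℝ)) :
    μHE[2] (triMap p '' B) = ENNReal.ofReal ‖areaVec p‖ * volume B := by
  -- `ℝ × ℝ` carries the sup metric, so it is first identified, preserving measure, with the
  -- Euclidean plane.
  let c : ℝ × ℝ ≃ᵐ EuclideanSpace ℝ (Fin 2) :=
    MeasurableEquiv.finTwoArrow.symm.trans (MeasurableEquiv.toLp 2 (Fin 2 → ℝ))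
  have hc : MeasurePreserving c volume volume :=
    (PiLp.volume_preserving_toLp (Fin 2)).comp (volume_preserving_finTwoArrow ℝ).symm
  let f : EuclideanSpace ℝ (Fin 2) →ₗ[ℝ] E3 :=
    (Fintype.linearCombination ℝ ![p 1 - p 0, p 2 - p 0]) ∘ₗ
      (WithLp.linearEquiv 2 ℝ (Fin 2 → ℝ)).toLinearMap
  have hf : ∀ y, f y = y 0 • (p 1 - p 0) + y 1 • (p 2 - p 0) := fun y => by
    simp [f, Fintype.linearCombination_apply, Fin.sum_univ_two]
  have hdet : f.normDet = ‖areaVec p‖ := by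
    rw [← sq_eq_sq₀ f.normDet_nonneg (norm_nonneg _), areaVec, norm_cross_sq]
    have := f.normDet_sq_eq_det_gram (EuclideanSpace.basisFun (Fin 2) ℝ)
    simp only [RCLike.ofReal_real_eq_id, id_eq] at this
    rw [this, Matrix.det_fin_two]
    simp only [Matrix.gram_apply, hf, EuclideanSpace.basisFun_apply, PiLp.single_apply]
    simp only [← real_inner_self_eq_norm_sq]
    simp [real_inner_comm (p 2 - p 0) (p 1 - p 0)]
    ring
  have h := f.euclideanHausdorffMeasure_image_eq_normDet_mul_volume (c '' B)
  rw [finrank_euclideanSpace_fin, hdet] at h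
  have hB : volume (c '' B) = volume B := by
    rw [← hc.measure_preimage_equiv, c.preimage_image]
  rw [← hB, ← h, ← (isometry_add_left (p 0)).euclideanHausdorffMeasure_image (f '' (c '' B)),
    Set.image_image, Set.image_image]
  congr 1
  refine Set.image_congr fun x _ => ?_
  rw [hf, triMap, add_assoc]
  rfl

lemma restrict_triangle (p : Fin 3 → E3) :
    (μHE[2] : Measure E3).restrict (triangle p)
      = ENNReal.ofReal ‖areaVec p‖ • (volume.restrict stdTriangle).map (triMap p) := by
  ext A hA
  rw [Measure.restrict_apply hA, Measure.smul_apply,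
    Measure.map_apply (continuous_triMap p).measurable hA,
    Measure.restrict_apply ((continuous_triMap p).measurable hA), triangle_eq_image,
    ← Set.image_preimage_inter, euclideanHausdorffMeasure_triMap_image, smul_eq_mul]

lemma integrableOn_triangle {p : Fin 3 → E3} {h : E3 → ℝ} (hh : ContinuousOn h (triangle p)) :
    IntegrableOn h (triangle p) μHE[2] := by
  have hfin : IsFiniteMeasure ((μHE[2] : Measure E3).restrict (triangle p)) := by
    rw [restrict_triangle]
    have : IsFiniteMeasure ((volume : Measure (ℝ × ℝ)).restrict stdTriangle) :=
      ⟨by simpa using isCompact_stdTriangle.measure_lt_top⟩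
    exact Measure.smul_finite _ ENNReal.ofReal_ne_top
  obtain ⟨C, hC⟩ := (isCompact_triangle p).exists_bound_of_continuousOn hh
  refine Integrable.of_bound (C := C)
    (hh.aestronglyMeasurable (isCompact_triangle p).measurableSet) ?_
  exact (ae_restrict_iff' (isCompact_triangle p).measurableSet).2 (Filter.Eventually.of_forall hC)

lemma integral_triangle {p : Fin 3 → E3} {h : E3 → ℝ} (hh : ContinuousOn h (triangle p)) :
    ∫ r in triangle p, h r ∂μHE[2]
      = ‖areaVec p‖ * ∫ x in stdTriangle, h (triMap p x) := by
  have hi := integrableOn_triangle hh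
  rw [IntegrableOn, restrict_triangle] at hi
  -- Measurability on the pushed-forward measure is read off from integrability against its
  -- multiple, which requires a nonzero factor.
  by_cases h0 : ‖areaVec p‖ = 0
  · rw [restrict_triangle, h0]; simp
  · rw [restrict_triangle, integral_smul_measure, ENNReal.toReal_ofReal (norm_nonneg _),
      integral_map (continuous_triMap p).aemeasurable, smul_eq_mul]
    exact ((integrable_smul_measure (by simpa using h0) ENNReal.ofReal_ne_top).1 hi).1

lemma integral_stdTriangle {F : ℝ × ℝ → ℝ} (hF : ContinuousOn F stdTriangle) :
    ∫ x in stdTriangle, F x = ∫ a in (0 : ℝ)..1, ∫ b in (0 : ℝ)..(1 - a), F (a, b) := by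
  have hm := isCompact_stdTriangle.measurableSet
  have hi : Integrable (stdTriangle.indicator F) :=
    (hF.integrableOn_compact isCompact_stdTriangle).integrable_indicator hm
  rw [← integral_indicator hm, Measure.volume_eq_prod, integral_prod _ hi,
    intervalIntegral.integral_of_le zero_le_one, ← integral_Icc_eq_integral_Ioc,
    ← integral_indicator measurableSet_Icc]
  congr 1
  ext a
  by_cases ha : a ∈ Set.Icc (0 : ℝ) 1
  · rw [Set.indicator_of_mem ha, intervalIntegral.integral_of_le (by linarith [ha.2]),
      ← integral_Icc_eq_integral_Ioc, ← integral_indicator measurableSet_Icc]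
    congr 1
    ext b
    by_cases hb : b ∈ Set.Icc 0 (1 - a)
    · rw [Set.indicator_of_mem hb, Set.indicator_of_mem]
      exact ⟨ha.1, hb.1, by simp only; linarith [hb.2]⟩
    · rw [Set.indicator_of_notMem hb, Set.indicator_of_notMem]
      rintro ⟨h1, h2, h3⟩
      exact hb ⟨h2, by simp only at h3; linarith⟩
  · rw [Set.indicator_of_notMem ha]
    refine integral_eq_zero_of_ae (Filter.Eventually.of_forall fun b => ?_)
    refine Set.indicator_of_notMem ?_ _
    rintro ⟨h1, h2, h3⟩
    simp only at h1 h2 h3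
    exact ha ⟨h1, by linarith⟩

/-! ### The divergence theorem in the triangle -/

lemma continuousOn_fderiv_apply {g : E3 → ℝ} {s : Set E3} (hg : ∀ r ∈ s, ContDiffAt ℝ 1 g r)
    (d : E3) : ContinuousOn (fun r => fderiv ℝ g r d) s := fun r hr =>
  (((hg r hr).fderiv_right (m := 0) (by simp)).continuousAt.clm_apply
    continuousAt_const).continuousWithinAt

/-- The integral over `T` of the derivative in the direction of the side `p₃ - p₁`. -/
lemma integral_triangle_fderiv_edge {p : Fin 3 → E3} {g : E3 → ℝ}
    (hg : ∀ r ∈ triangle p, ContDiffAt ℝ 1 g r) :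
    ∫ r in triangle p, fderiv ℝ g r (p 2 - p 0) ∂μHE[2]
      = ‖areaVec p‖ * ((∫ a in (0 : ℝ)..1, g (triMap p (a, 1 - a)))
        - ∫ a in (0 : ℝ)..1, g (triMap p (a, 0))) := by
  have hc := continuousOn_fderiv_apply hg (p 2 - p 0)
  have hmaps : Set.MapsTo (triMap p) stdTriangle (triangle p) := fun x hx => triMap_mem hx
  have hcΦ : ContinuousOn (fun x => fderiv ℝ g (triMap p x) (p 2 - p 0)) stdTriangle :=
    hc.comp (continuous_triMap p).continuousOn hmaps
  have hgc : ContinuousOn g (triangle p) := fun r hr => (hg r hr).continuousAt.continuousWithinAt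
  rw [integral_triangle hc, integral_stdTriangle hcΦ, ← intervalIntegral.integral_sub]
  · congr 1
    refine intervalIntegral.integral_congr fun a ha => ?_
    rw [Set.uIcc_of_le zero_le_one] at ha
    have hmem : ∀ b ∈ Set.uIcc 0 (1 - a), (a, b) ∈ stdTriangle := fun b hb => by
      rw [Set.uIcc_of_le (by linarith [ha.2])] at hb
      exact ⟨ha.1, hb.1, by simp only; linarith [hb.2]⟩
    refine intervalIntegral.integral_eq_sub_of_hasDerivAt (f := fun b => g (triMap p (a, b)))
      (fun b hb => ?_) ?_
    · have h1 := ((hg _ (triMap_mem (hmem b hb))).differentiableAt (by simp)).hasFDerivAt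
      refine h1.comp_hasDerivAt b ?_
      simpa [triMap] using ((hasDerivAt_id b).smul_const (p 2 - p 0)).const_add
        (p 0 + a • (p 1 - p 0))
    · exact (hcΦ.comp (f := fun b : ℝ => (a, b)) (by fun_prop) hmem).intervalIntegrable
  · refine ((hgc.comp (continuous_triMap p).continuousOn hmaps).comp
      (f := fun a : ℝ => (a, 1 - a)) (by fun_prop) fun a ha => ?_).intervalIntegrable
    rw [Set.uIcc_of_le zero_le_one] at ha
    exact ⟨ha.1, by simp only; linarith [ha.2], by simp⟩
  · refine ((hgc.comp (continuous_triMap p).continuousOn hmaps).comp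
      (f := fun a : ℝ => (a, (0 : ℝ))) (by fun_prop) fun a ha => ?_).intervalIntegrable
    rw [Set.uIcc_of_le zero_le_one] at ha
    exact ⟨ha.1, le_rfl, by simpa using ha.2⟩

/-- The mean of `g` over the `i`-th side. -/
noncomputable def sideMean (p : Fin 3 → E3) (g : E3 → ℝ) (i : Fin 3) : ℝ :=
  ∫ a in (0 : ℝ)..1, g (p (i + 1) + a • side p i)

/-- Reverses a side: the parametrisation of `triMap` may run along it against the orientation of
`side`. -/
lemma intervalIntegral_one_sub (f : ℝ → ℝ) :
    ∫ a in (0 : ℝ)..1, f (1 - a) = ∫ a in (0 : ℝ)..1, f a := by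
  simp

lemma integral_triangle_fderiv_right {p : Fin 3 → E3} {g : E3 → ℝ}
    (hg : ∀ r ∈ triangle p, ContDiffAt ℝ 1 g r) :
    ∫ r in triangle p, fderiv ℝ g r (p 2 - p 0) ∂μHE[2]
      = ‖areaVec p‖ * (sideMean p g 0 - sideMean p g 2) := by
  rw [integral_triangle_fderiv_edge hg, sideMean, sideMean, ← intervalIntegral_one_sub]
  congr 3 with a
  · congr 1
    rw [triMap, side_zero, show (0 : Fin 3) + 1 = 1 from rfl]
    module
  · congr 1
    rw [triMap, side_two, show (2 : Fin 3) + 1 = 0 from rfl]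
    module

/-- Exchanging the nodes `p 1` and `p 2` leaves the triangle unchanged and only flips the sign of
`areaVec`, so the edge formula applies again. -/
lemma integral_triangle_fderiv_left {p : Fin 3 → E3} {g : E3 → ℝ}
    (hg : ∀ r ∈ triangle p, ContDiffAt ℝ 1 g r) :
    ∫ r in triangle p, fderiv ℝ g r (p 1 - p 0) ∂μHE[2]
      = ‖areaVec p‖ * (sideMean p g 0 - sideMean p g 1) := by
  have ht : triangle (p ∘ Equiv.swap 1 2) = triangle p := by
    rw [triangle, triangle, (Equiv.swap (1 : Fin 3) 2).surjective.range_comp]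
  have h0 : (p ∘ Equiv.swap 1 2) 0 = p 0 := by simp [Equiv.swap_apply_def]
  have h1 : (p ∘ Equiv.swap 1 2) 1 = p 2 := by simp
  have h2 : (p ∘ Equiv.swap 1 2) 2 = p 1 := by simp
  have h := integral_triangle_fderiv_edge (p := p ∘ Equiv.swap 1 2) (g := g) (by rwa [ht])
  rw [ht, areaVec, cross_antisymm, norm_neg] at h
  simp only [triMap, h0, h1, h2] at h
  rw [h, areaVec, sideMean, sideMean,
    ← intervalIntegral_one_sub fun a => g (p (1 + 1) + a • side p 1)]
  congr 3 with a
  · congr 1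
    rw [side_zero, show (0 : Fin 3) + 1 = 1 from rfl]
    module
  · congr 1
    rw [side_one, show (1 : Fin 3) + 1 = 2 from rfl]
    module

/-- The divergence theorem in the triangle for a vector field with the fixed tangential
direction `d`. -/
theorem integral_triangle_fderiv {p : Fin 3 → E3} (hp : AffineIndependent ℝ p) {g : E3 → ℝ}
    (hg : ∀ r ∈ triangle p, ContDiffAt ℝ 1 g r) {d : E3} (hd : ⟪d, wHat p⟫ = 0) :
    ∫ r in triangle p, fderiv ℝ g r d ∂μHE[2]
      = ∑ i, ⟪d, mHat p i⟫ * (sideLen p i * sideMean p g i) := by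
  -- By linearity it suffices to know the two edges at `p 0`. They span the tangential vectors
  -- because the component `c` of `p 2 - p 0` along `m̂₃` is nonzero (the area is), which gives `β =
  -- (d·m̂₃)/c`.
  obtain ⟨α, β, rfl⟩ : ∃ α β : ℝ, d = α • (p 1 - p 0) + β • (p 2 - p 0) := by
    have h1 := eq_of_inner_wHat_eq_zero hp 2 hd
    have h2 := eq_of_inner_wHat_eq_zero hp 2 (inner_sub_wHat hp 2)
    have h3 := sideLen_smul_sHat hp 2
    have h4 := sideLen_pos hp 2
    have h5 := sideLen_mul_inner_mHat hp 2 (p 2 - p 0)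
    rw [side_two, cross_antisymm, ← areaVec, inner_neg_right, inner_wHat_areaVec hp] at h5
    have h6 : ⟪p 2 - p 0, mHat p 2⟫ ≠ 0 := by
      intro h
      rw [h, mul_zero] at h5
      exact areaVec_ne_zero hp (norm_eq_zero.1 (by linarith))
    rw [side_two] at h3
    set c := ⟪p 2 - p 0, mHat p 2⟫
    set e := ⟪p 2 - p 0, sHat p 2⟫
    refine ⟨(⟪d, sHat p 2⟫ - ⟪d, mHat p 2⟫ * c⁻¹ * e) * (sideLen p 2)⁻¹, ⟪d, mHat p 2⟫ * c⁻¹, ?_⟩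
    rw [h2, ← h3, smul_smul, inv_mul_cancel_right₀ h4.ne', smul_add, smul_smul, smul_smul,
      inv_mul_cancel_right₀ h6]
    nth_rewrite 1 [h1]
    module
  have hi1 := integrableOn_triangle (continuousOn_fderiv_apply hg (p 1 - p 0))
  have hi2 := integrableOn_triangle (continuousOn_fderiv_apply hg (p 2 - p 0))
  simp only [map_add, map_smul, smul_eq_mul]
  rw [integral_add (hi1.const_mul α) (hi2.const_mul β), integral_const_mul, integral_const_mul,
    integral_triangle_fderiv_left hg, integral_triangle_fderiv_right hg]
  -- As triple products, the coefficients `s_i (d·m̂_i)` for the two edges are `0` or `±|areaVec|`,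
  -- exactly the factors in the two edge formulas.
  have key : ∀ i, ⟪α • (p 1 - p 0) + β • (p 2 - p 0), mHat p i⟫ * (sideLen p i * sideMean p g i)
      = (α * ⟪wHat p, cross (p 1 - p 0) (side p i)⟫ + β * ⟪wHat p, cross (p 2 - p 0) (side p i)⟫)
        * sideMean p g i := fun i => by
    rw [← sideLen_mul_inner_mHat hp, ← sideLen_mul_inner_mHat hp, inner_add_left,
      inner_smul_left, inner_smul_left, conj_trivial, conj_trivial]
    ring
  have c10 : cross (p 1 - p 0) (side p 0) = areaVec p := by
    rw [side_zero, areaVec]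
    apply E3.ext <;> simp [cross_apply_zero, cross_apply_one, cross_apply_two] <;> ring
  have c11 : cross (p 1 - p 0) (side p 1) = (-1 : ℝ) • areaVec p := by
    rw [side_one, areaVec]
    apply E3.ext <;> simp [cross_apply_zero, cross_apply_one, cross_apply_two] <;> ring
  have c12 : cross (p 1 - p 0) (side p 2) = (0 : ℝ) • areaVec p := by
    rw [side_two, areaVec]
    apply E3.ext <;> simp [cross_apply_zero, cross_apply_one, cross_apply_two] <;> ring
  have c20 : cross (p 2 - p 0) (side p 0) = areaVec p := by
    rw [side_zero, areaVec]
    apply E3.ext <;> simp [cross_apply_zero, cross_apply_one, cross_apply_two] <;> ring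
  have c21 : cross (p 2 - p 0) (side p 1) = (0 : ℝ) • areaVec p := by
    rw [side_one, areaVec]
    apply E3.ext <;> simp [cross_apply_zero, cross_apply_one, cross_apply_two] <;> ring
  have c22 : cross (p 2 - p 0) (side p 2) = (-1 : ℝ) • areaVec p := by
    rw [side_two, areaVec]
    apply E3.ext <;> simp [cross_apply_zero, cross_apply_one, cross_apply_two] <;> ring
  rw [Fin.sum_univ_three, key, key, key, c10, c11, c12, c20, c21, c22]
  simp only [inner_smul_right, inner_wHat_areaVec hp]
  ring

/-! ### Integrals along the sides -/

section Primitives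

variable {t w s : ℝ}

lemma hasDerivAt_sqrt_sq_add (h : 0 < t ^ 2 + w ^ 2) :
    HasDerivAt (fun s => √(s ^ 2 + t ^ 2 + w ^ 2)) (s / √(s ^ 2 + t ^ 2 + w ^ 2)) s := by
  have h1 : s ^ 2 + t ^ 2 + w ^ 2 ≠ 0 := by nlinarith [sq_nonneg s]
  have h2 := ((((hasDerivAt_id' s).fun_pow 2).add_const (t ^ 2)).add_const (w ^ 2)).sqrt h1
  refine h2.congr_deriv ?_
  field_simp
  norm_num

lemma sqrt_sq_add_pos (h : 0 < t ^ 2 + w ^ 2) : 0 < √(s ^ 2 + t ^ 2 + w ^ 2) :=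
  Real.sqrt_pos.2 (by nlinarith [sq_nonneg s])

lemma sqrt_sq_add_sq : √(s ^ 2 + t ^ 2 + w ^ 2) ^ 2 = s ^ 2 + t ^ 2 + w ^ 2 :=
  Real.sq_sqrt (by positivity)

lemma sqrt_sq_add_add_pos (h : 0 < t ^ 2 + w ^ 2) : 0 < √(s ^ 2 + t ^ 2 + w ^ 2) + s := by
  have : |s| < √(s ^ 2 + t ^ 2 + w ^ 2) := by
    rw [← Real.sqrt_sq_eq_abs]
    exact Real.sqrt_lt_sqrt (sq_nonneg s) (by linarith)
  linarith [neg_abs_le s]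

lemma integral_inv_sqrt_cube (h : 0 < t ^ 2 + w ^ 2) (a b : ℝ) :
    ∫ s in a..b, (√(s ^ 2 + t ^ 2 + w ^ 2) ^ 3)⁻¹
      = 1 / (t ^ 2 + w ^ 2) * (b / √(b ^ 2 + t ^ 2 + w ^ 2) - a / √(a ^ 2 + t ^ 2 + w ^ 2)) := by
  rw [intervalIntegral.integral_eq_sub_of_hasDerivAt
    (f := fun s => 1 / (t ^ 2 + w ^ 2) * (s / √(s ^ 2 + t ^ 2 + w ^ 2)))]
  · ring
  · intro s _
    have hp := sqrt_sq_add_pos (s := s) h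
    have hsq := sqrt_sq_add_sq (s := s) (t := t) (w := w)
    refine (((hasDerivAt_id' s).fun_div (hasDerivAt_sqrt_sq_add (s := s) h) hp.ne').const_mul
      (1 / (t ^ 2 + w ^ 2))).congr_deriv ?_
    set N := √(s ^ 2 + t ^ 2 + w ^ 2)
    field_simp
    linear_combination hsq
  · refine Continuous.intervalIntegrable ?_ _ _
    exact Continuous.inv₀ (by fun_prop) fun s => (pow_pos (sqrt_sq_add_pos h) 3).ne'

lemma integral_mul_inv_sqrt_cube (h : 0 < t ^ 2 + w ^ 2) (a b : ℝ) :
    ∫ s in a..b, s * (√(s ^ 2 + t ^ 2 + w ^ 2) ^ 3)⁻¹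
      = (√(a ^ 2 + t ^ 2 + w ^ 2))⁻¹ - (√(b ^ 2 + t ^ 2 + w ^ 2))⁻¹ := by
  rw [intervalIntegral.integral_eq_sub_of_hasDerivAt
    (f := fun s => -(√(s ^ 2 + t ^ 2 + w ^ 2))⁻¹)]
  · ring
  · intro s _
    have hp := sqrt_sq_add_pos (s := s) h
    refine ((hasDerivAt_sqrt_sq_add (s := s) h).fun_inv hp.ne').fun_neg.congr_deriv ?_
    field_simp
  · refine Continuous.intervalIntegrable ?_ _ _
    exact continuous_id.mul
      (Continuous.inv₀ (by fun_prop) fun s => (pow_pos (sqrt_sq_add_pos h) 3).ne')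

lemma integral_inv_sqrt (h : 0 < t ^ 2 + w ^ 2) (a b : ℝ) :
    ∫ s in a..b, (√(s ^ 2 + t ^ 2 + w ^ 2))⁻¹
      = Real.log ((√(b ^ 2 + t ^ 2 + w ^ 2) + b) / (√(a ^ 2 + t ^ 2 + w ^ 2) + a)) := by
  rw [Real.log_div (sqrt_sq_add_add_pos h).ne' (sqrt_sq_add_add_pos h).ne',
    intervalIntegral.integral_eq_sub_of_hasDerivAt
    (f := fun s => Real.log (√(s ^ 2 + t ^ 2 + w ^ 2) + s))]
  · intro s _
    have hp := sqrt_sq_add_pos (s := s) h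
    have hp' := sqrt_sq_add_add_pos (s := s) h
    refine (((hasDerivAt_sqrt_sq_add (s := s) h).fun_add (hasDerivAt_id' s)).log
      hp'.ne').congr_deriv ?_
    field_simp
    ring
  · refine Continuous.intervalIntegrable ?_ _ _
    exact Continuous.inv₀ (by fun_prop) fun s => (sqrt_sq_add_pos h).ne'

lemma mul_integral_inv_sqrt_mul (h : 0 < t ^ 2 + w ^ 2) (a b : ℝ) :
    t * ∫ s in a..b, (√(s ^ 2 + t ^ 2 + w ^ 2) * (√(s ^ 2 + t ^ 2 + w ^ 2) + |w|))⁻¹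
      = Real.arctan (t * b / (t ^ 2 + w ^ 2 + |w| * √(b ^ 2 + t ^ 2 + w ^ 2)))
        - Real.arctan (t * a / (t ^ 2 + w ^ 2 + |w| * √(a ^ 2 + t ^ 2 + w ^ 2))) := by
  rw [← intervalIntegral.integral_const_mul, intervalIntegral.integral_eq_sub_of_hasDerivAt
    (f := fun s => Real.arctan (t * s / (t ^ 2 + w ^ 2 + |w| * √(s ^ 2 + t ^ 2 + w ^ 2))))]
  · intro s _
    have hp := sqrt_sq_add_pos (s := s) h
    have hsq := sqrt_sq_add_sq (s := s) (t := t) (w := w)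
    have hN := hasDerivAt_sqrt_sq_add (s := s) h
    have hw : w ^ 2 = |w| ^ 2 := (sq_abs w).symm
    have hw0 := abs_nonneg w
    have hden : 0 < t ^ 2 + w ^ 2 + |w| * √(s ^ 2 + t ^ 2 + w ^ 2) := by positivity
    refine (((hasDerivAt_id' s).const_mul t).fun_div
      ((hN.const_mul |w|).const_add (t ^ 2 + w ^ 2)) hden.ne').arctan.congr_deriv ?_
    set N := √(s ^ 2 + t ^ 2 + w ^ 2)
    set k := |w|
    have hs : s ^ 2 = N ^ 2 - t ^ 2 - k ^ 2 := by rw [hsq, hw]; ring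
    rw [hw] at hden h ⊢
    -- With `N² = s² + t² + k²`, this factorisation turns the denominator `1 + x²` of the derivative
    -- of `arctan` into a product, which then cancels.
    have e1 : (t ^ 2 + k ^ 2 + k * N) ^ 2 + (t * s) ^ 2 = (t ^ 2 + k ^ 2) * (N + k) ^ 2 := by
      rw [mul_pow, hs]; ring
    have e2 : 1 + (t * s / (t ^ 2 + k ^ 2 + k * N)) ^ 2
        = (t ^ 2 + k ^ 2) * (N + k) ^ 2 / (t ^ 2 + k ^ 2 + k * N) ^ 2 := by
      rw [← e1]; field_simp
    rw [e2]
    have : 0 < N + k := by positivity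
    field_simp
    rw [hs]
    ring
  · refine Continuous.intervalIntegrable ?_ _ _
    refine continuous_const.mul (Continuous.inv₀ (by fun_prop) fun s => ?_)
    have hp := sqrt_sq_add_pos (s := s) h
    positivity

end Primitives

/-- The `i`-th side, parametrised by the signed distance to the foot of the perpendicular. -/
noncomputable def sidePoint (p : Fin 3 → E3) (r₀ : E3) (i : Fin 3) (s : ℝ) : E3 :=
  rho p r₀ + t0 p r₀ i • mHat p i + s • sHat p i

lemma sideLen_mul_sideMean {p : Fin 3 → E3} (hp : AffineIndependent ℝ p) (r₀ : E3) (g : E3 → ℝ)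
    (i : Fin 3) :
    sideLen p i * sideMean p g i
      = ∫ s in sMinus p r₀ i..sPlus p r₀ i, g (sidePoint p r₀ i s) := by
  have h := intervalIntegral.mul_integral_comp_add_mul (a := 0) (b := 1)
    (f := fun s => g (sidePoint p r₀ i s)) (sideLen p i) (sMinus p r₀ i)
  rw [mul_zero, add_zero, mul_one, ← sPlus_eq hp] at h
  rw [← h, sideMean]
  congr 3 with a
  congr 1
  rw [sidePoint, ← sideLen_smul_sHat hp, ← sub_eq_zero]
  have := node_sub_rho hp r₀ i
  rw [sub_eq_iff_eq_add] at this
  rw [this]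
  module

lemma sidePoint_sub {p : Fin 3 → E3} (hp : AffineIndependent ℝ p) (r₀ : E3) (i : Fin 3) (s : ℝ) :
    sidePoint p r₀ i s - r₀ = t0 p r₀ i • mHat p i + s • sHat p i + w0 p r₀ • wHat p := by
  rw [← rho_sub p hp r₀, sidePoint]
  module

lemma inner_sidePoint_sub {p : Fin 3 → E3} (hp : AffineIndependent ℝ p) (r₀ : E3) (i : Fin 3)
    (s : ℝ) {d : E3} (hd : ⟪d, wHat p⟫ = 0) :
    ⟪d, sidePoint p r₀ i s - r₀⟫ = ⟪d, mHat p i⟫ * t0 p r₀ i + ⟪d, sHat p i⟫ * s := by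
  rw [sidePoint_sub hp, inner_add_right, inner_add_right, inner_smul_right, inner_smul_right,
    inner_smul_right, hd]
  ring

lemma norm_sidePoint_sub {p : Fin 3 → E3} (hp : AffineIndependent ℝ p) (r₀ : E3) (i : Fin 3)
    (s : ℝ) : ‖sidePoint p r₀ i s - r₀‖ = √(s ^ 2 + t0 p r₀ i ^ 2 + w0 p r₀ ^ 2) := by
  rw [← Real.sqrt_sq (norm_nonneg _), ← real_inner_self_eq_norm_sq, sidePoint_sub hp]
  simp only [inner_add_left, inner_add_right, inner_smul_left, inner_smul_right, conj_trivial,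
    real_inner_self_eq_norm_sq, norm_mHat hp, norm_sHat hp, norm_wHat hp, inner_mHat_sHat,
    inner_mHat_wHat, inner_sHat_wHat hp, real_inner_comm (mHat p i) (sHat p i),
    real_inner_comm (mHat p i) (wHat p), real_inner_comm (sHat p i) (wHat p)]
  congr 1
  ring

/-- On a side the length `R` depends on `s` alone and `d·R` is affine in `s`, so any radial weight
`G` leaves just two one-dimensional integrals. -/
lemma sideMean_inner_mul {p : Fin 3 → E3} (hp : AffineIndependent ℝ p) {r₀ : E3} {i : Fin 3}
    (h : 0 < t0 p r₀ i ^ 2 + w0 p r₀ ^ 2) {G : ℝ → ℝ} (hG : ContinuousOn G (Set.Ioi 0))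
    {d : E3} (hd : ⟪d, wHat p⟫ = 0) :
    sideLen p i * sideMean p (fun r => ⟪d, r - r₀⟫ * G ‖r - r₀‖) i
      = ⟪d, mHat p i⟫ * (t0 p r₀ i * ∫ s in sMinus p r₀ i..sPlus p r₀ i,
          G √(s ^ 2 + t0 p r₀ i ^ 2 + w0 p r₀ ^ 2))
        + ⟪d, sHat p i⟫ * ∫ s in sMinus p r₀ i..sPlus p r₀ i,
          s * G √(s ^ 2 + t0 p r₀ i ^ 2 + w0 p r₀ ^ 2) := by
  have hc : Continuous fun s => G √(s ^ 2 + t0 p r₀ i ^ 2 + w0 p r₀ ^ 2) :=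
    hG.comp_continuous (by fun_prop) fun s => sqrt_sq_add_pos h
  rw [sideLen_mul_sideMean hp r₀]
  simp only [inner_sidePoint_sub hp r₀ i _ hd, norm_sidePoint_sub hp]
  rw [← mul_assoc, ← intervalIntegral.integral_const_mul, ← intervalIntegral.integral_const_mul,
    ← intervalIntegral.integral_add]
  · congr 1 with s
    ring
  · exact (continuous_const.mul hc).intervalIntegrable _ _
  · exact (continuous_const.mul (continuous_id.mul hc)).intervalIntegrable _ _

lemma sideMean_norm {p : Fin 3 → E3} (hp : AffineIndependent ℝ p) (r₀ : E3) (i : Fin 3)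
    (G : ℝ → ℝ) :
    sideLen p i * sideMean p (fun r => G ‖r - r₀‖) i
      = ∫ s in sMinus p r₀ i..sPlus p r₀ i, G √(s ^ 2 + t0 p r₀ i ^ 2 + w0 p r₀ ^ 2) := by
  rw [sideLen_mul_sideMean hp r₀]
  simp only [norm_sidePoint_sub hp]

lemma sideMean_inv_norm_cube {p : Fin 3 → E3} (hp : AffineIndependent ℝ p) {r₀ : E3} {i : Fin 3}
    (h : 0 < t0 p r₀ i ^ 2 + w0 p r₀ ^ 2) :
    sideLen p i * sideMean p (fun r => (‖r - r₀‖ ^ 3)⁻¹) i = Rs p r₀ i := by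
  rw [sideMean_norm hp r₀ i fun x => (x ^ 3)⁻¹, integral_inv_sqrt_cube h, Rs, R0_sq]
  rfl

lemma sideMean_inv_norm {p : Fin 3 → E3} (hp : AffineIndependent ℝ p) {r₀ : E3} {i : Fin 3}
    (h : 0 < t0 p r₀ i ^ 2 + w0 p r₀ ^ 2) :
    sideLen p i * sideMean p (fun r => ‖r - r₀‖⁻¹) i = f2 p r₀ i := by
  rw [sideMean_norm hp r₀ i fun x => x⁻¹, integral_inv_sqrt h]
  rfl

lemma sideMean_inner_mul_inv_norm_cube {p : Fin 3 → E3} (hp : AffineIndependent ℝ p) {r₀ : E3}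
    {i : Fin 3} (h : 0 < t0 p r₀ i ^ 2 + w0 p r₀ ^ 2) {d : E3} (hd : ⟪d, wHat p⟫ = 0) :
    sideLen p i * sideMean p (fun r => ⟪d, r - r₀⟫ * (‖r - r₀‖ ^ 3)⁻¹) i
      = ⟪d, Rd p r₀ i • sHat p i + Rs p r₀ i • (t0 p r₀ i • mHat p i)⟫ := by
  rw [sideMean_inner_mul hp h (G := fun x => (x ^ 3)⁻¹) _ hd, integral_inv_sqrt_cube h,
    integral_mul_inv_sqrt_cube h, inner_add_right, inner_smul_right, inner_smul_right,
    inner_smul_right, Rs, Rd, R0_sq, RPlus, RMinus]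
  · ring
  · exact ContinuousOn.inv₀ (by fun_prop) fun x hx => (pow_pos hx 3).ne'

/-- The pair `{û, v̂}` resolves the inner product of tangential vectors. -/
lemma sum_inner_axis {p : Fin 3 → E3} (hp : AffineIndependent ℝ p) {x y : E3}
    (hx : ⟪x, wHat p⟫ = 0) :
    ∑ k, ⟪axis p k, x⟫ * ⟪axis p k, y⟫ = ⟪x, y⟫ := by
  rw [inner_eq_sum_frame hp, Fin.sum_univ_two, real_inner_comm _ (wHat p), hx]
  simp [axis]

lemma axis_inner_wHat {p : Fin 3 → E3} (hp : AffineIndependent ℝ p) (k : Fin 2) :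
    ⟪axis p k, wHat p⟫ = 0 := by
  fin_cases k
  · exact uHat_inner_wHat hp
  · exact vHat_inner_wHat p

/-- This is the outward flux of a radial field through one side. Only `R·m̂_i = t_i⁰`, constant
along the side, survives; the part along `ŝ_i` is orthogonal to `m̂_i`. -/
lemma sum_sideMean_inner_axis_mul {p : Fin 3 → E3} (hp : AffineIndependent ℝ p) {r₀ : E3}
    {i : Fin 3} (h : 0 < t0 p r₀ i ^ 2 + w0 p r₀ ^ 2) {G : ℝ → ℝ}
    (hG : ContinuousOn G (Set.Ioi 0)) :
    ∑ k, ⟪axis p k, mHat p i⟫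
        * (sideLen p i * sideMean p (fun r => ⟪axis p k, r - r₀⟫ * G ‖r - r₀‖) i)
      = t0 p r₀ i * ∫ s in sMinus p r₀ i..sPlus p r₀ i,
          G √(s ^ 2 + t0 p r₀ i ^ 2 + w0 p r₀ ^ 2) := by
  simp only [sideMean_inner_mul hp h hG (axis_inner_wHat hp _), mul_add, ← mul_assoc _ ⟪_, _⟫]
  have h1 := sum_inner_axis hp (y := mHat p i) (inner_mHat_wHat p i)
  have h2 := sum_inner_axis hp (y := sHat p i) (inner_mHat_wHat p i)
  rw [real_inner_self_eq_norm_sq, norm_mHat hp] at h1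
  rw [inner_mHat_sHat] at h2
  rw [Finset.sum_add_distrib, ← Finset.sum_mul, ← Finset.sum_mul, h1, h2]
  ring

/-! ### Radial functions -/

section Radial

variable {r₀ r : E3} {φ : ℝ → ℝ} {φ' : ℝ}

lemma hasFDerivAt_comp_norm_sub (hr : r ≠ r₀) (hφ : HasDerivAt φ φ' ‖r - r₀‖) :
    HasFDerivAt (fun r => φ ‖r - r₀‖) ((φ' / ‖r - r₀‖) • innerSL ℝ (r - r₀)) r := by
  have hn : ‖r - r₀‖ ≠ 0 := norm_ne_zero_iff.2 (sub_ne_zero.2 hr)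
  have h1 : HasFDerivAt (fun r : E3 => ‖r - r₀‖ ^ 2) ((2 : ℝ) • innerSL ℝ (r - r₀)) r := by
    have := (hasStrictFDerivAt_norm_sq (r - r₀)).hasFDerivAt.comp r
      ((hasFDerivAt_id r).sub_const r₀)
    refine this.congr_fderiv ?_
    ext x
    simp
  have h2 := h1.sqrt (pow_ne_zero 2 hn)
  simp only [Real.sqrt_sq (norm_nonneg _)] at h2
  refine (hφ.comp_hasFDerivAt r h2).congr_fderiv ?_
  rw [smul_smul, smul_smul]
  congr 1
  field_simp

lemma contDiffAt_comp_norm_sub (hr : r ≠ r₀) (hφ : ContDiffAt ℝ 1 φ ‖r - r₀‖) :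
    ContDiffAt ℝ 1 (fun r => φ ‖r - r₀‖) r :=
  hφ.comp r ((contDiffAt_id.sub contDiffAt_const).norm ℝ (sub_ne_zero.2 hr))

lemma contDiffAt_inner_mul_comp_norm_sub (a : E3) (hr : r ≠ r₀)
    (hφ : ContDiffAt ℝ 1 φ ‖r - r₀‖) :
    ContDiffAt ℝ 1 (fun r => ⟪a, r - r₀⟫ * φ ‖r - r₀‖) r :=
  (contDiffAt_const.inner ℝ (contDiffAt_id.sub contDiffAt_const)).mul
    (contDiffAt_comp_norm_sub hr hφ)

lemma fderiv_norm_sub_apply (hr : r ≠ r₀) (hφ : HasDerivAt φ φ' ‖r - r₀‖) (d : E3) :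
    fderiv ℝ (fun r => φ ‖r - r₀‖) r d = φ' / ‖r - r₀‖ * ⟪d, r - r₀⟫ := by
  rw [(hasFDerivAt_comp_norm_sub hr hφ).fderiv, real_inner_comm, smul_apply,
    innerSL_apply_apply, smul_eq_mul]

lemma fderiv_inner_mul_norm_sub_apply (a : E3) (hr : r ≠ r₀) (hφ : HasDerivAt φ φ' ‖r - r₀‖)
    (d : E3) :
    fderiv ℝ (fun r => ⟪a, r - r₀⟫ * φ ‖r - r₀‖) r d
      = ⟪a, d⟫ * φ ‖r - r₀‖ + ⟪a, r - r₀⟫ * (φ' / ‖r - r₀‖ * ⟪d, r - r₀⟫) := by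
  have h1 : HasFDerivAt (fun r : E3 => ⟪a, r - r₀⟫) (innerSL ℝ a) r :=
    (innerSL ℝ a).hasFDerivAt.comp r ((hasFDerivAt_id r).sub_const r₀)
  rw [(h1.fun_mul (hasFDerivAt_comp_norm_sub hr hφ)).fderiv, real_inner_comm (r - r₀) d]
  simp only [add_apply, smul_apply, innerSL_apply_apply,
    smul_eq_mul]
  ring

end Radial

lemma hasDerivAt_inv_cube {x : ℝ} (hx : 0 < x) :
    HasDerivAt (fun x : ℝ => (x ^ 3)⁻¹) (-3 / x ^ 4) x := by
  refine ((hasDerivAt_id' x).fun_pow 3).fun_inv (pow_ne_zero 3 hx.ne') |>.congr_deriv ?_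
  field_simp
  norm_num
  ring

lemma hasDerivAt_inv_mul_add {x h : ℝ} (hx : 0 < x) (hh : 0 ≤ h) :
    HasDerivAt (fun x : ℝ => (x * (x + h))⁻¹) (-(2 * x + h) / (x * (x + h)) ^ 2) x := by
  have : 0 < x + h := by positivity
  refine ((hasDerivAt_id' x).fun_mul ((hasDerivAt_id' x).add_const h)).fun_inv
    (by positivity) |>.congr_deriv ?_
  ring

lemma contDiffAt_inv_cube {x : ℝ} (hx : 0 < x) : ContDiffAt ℝ 1 (fun x : ℝ => (x ^ 3)⁻¹) x :=
  (contDiffAt_id.pow 3).inv (pow_ne_zero 3 hx.ne')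

lemma contDiffAt_inv_mul_add {x h : ℝ} (hx : 0 < x) (hh : 0 ≤ h) :
    ContDiffAt ℝ 1 (fun x : ℝ => (x * (x + h))⁻¹) x :=
  (contDiffAt_id.mul (contDiffAt_id.add contDiffAt_const)).inv (by
    have : 0 < x + h := by positivity
    simp only [id]
    positivity)

/-! ### The flux density as a divergence -/

lemma inner_sub_wHat_of_mem {p : Fin 3 → E3} (hp : AffineIndependent ℝ p) {r : E3}
    (hr : r ∈ triangle p) : ⟪r - p 0, wHat p⟫ = 0 := by
  rw [triangle_eq_image] at hr
  obtain ⟨x, -, rfl⟩ := hr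
  rw [triMap, add_assoc, add_sub_cancel_left, inner_add_left, inner_smul_left, inner_smul_left,
    inner_sub_wHat hp, inner_sub_wHat hp]
  simp

lemma inner_wHat_sub_of_mem {p : Fin 3 → E3} (hp : AffineIndependent ℝ p) {r : E3} (r₀ : E3)
    (hr : r ∈ triangle p) : ⟪wHat p, r - r₀⟫ = w0 p r₀ := by
  rw [real_inner_comm, ← sub_sub_sub_cancel_right _ _ (p 0), inner_sub_left,
    inner_sub_wHat_of_mem hp hr, w0, zero_sub]

lemma normalFlux_eq_fderiv {p : Fin 3 → E3} (q r₀ r : E3) :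
    normalFlux p q r₀ r = fderiv ℝ (fun r => ⟪q, r - r₀⟫ * (‖r - r₀‖ ^ 3)⁻¹) r (wHat p) := by
  rw [normalFlux, real_inner_comm, gradient, InnerProductSpace.toDual_symm_apply]
  rfl

/-- `ρ - r₀` is normal to the plane, so `ρ` may be replaced by `r₀` and the moments involve `R`
only. -/
lemma coordA_eq {p : Fin 3 → E3} (hp : AffineIndependent ℝ p) (r₀ : E3) (k : Fin 2) (r : E3) :
    coordA p r₀ k r = ⟪axis p k, r - r₀⟫ := by
  have h : r - r₀ = (r - rho p r₀) + w0 p r₀ • wHat p := by rw [← rho_sub p hp]; abel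
  rw [coordA, h, inner_add_right, inner_smul_right, axis_inner_wHat hp]
  simp

/-- The tangential part of `q`. -/
noncomputable def tangential (p : Fin 3 → E3) (q : E3) : E3 :=
  ⟪uHat p, q⟫ • uHat p + ⟪vHat p, q⟫ • vHat p

lemma eq_tangential_add {p : Fin 3 → E3} (hp : AffineIndependent ℝ p) (q : E3) :
    q = tangential p q + ⟪wHat p, q⟫ • wHat p := eq_sum_frame hp q

lemma tangential_inner_wHat {p : Fin 3 → E3} (hp : AffineIndependent ℝ p) (q : E3) :
    ⟪tangential p q, wHat p⟫ = 0 := by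
  rw [tangential, inner_add_left, inner_smul_left, inner_smul_left, uHat_inner_wHat hp,
    vHat_inner_wHat]
  simp

lemma tangential_inner {p : Fin 3 → E3} (hp : AffineIndependent ℝ p) (q : E3) {d : E3}
    (hd : ⟪d, wHat p⟫ = 0) : ⟪tangential p q, d⟫ = ⟪q, d⟫ := by
  conv_rhs => rw [eq_tangential_add hp q]
  rw [inner_add_left, inner_smul_left, real_inner_comm d (wHat p), hd]
  simp

/-- Tangential divergence of a radial field in the plane of the triangle. -/
lemma sum_fderiv_axis {p : Fin 3 → E3} (hp : AffineIndependent ℝ p) {r₀ r : E3}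
    (hr : r ∈ triangle p) (hne : r ≠ r₀) {φ : ℝ → ℝ} {φ' : ℝ} (hφ : HasDerivAt φ φ' ‖r - r₀‖) :
    ∑ k, fderiv ℝ (fun r => ⟪axis p k, r - r₀⟫ * φ ‖r - r₀‖) r (axis p k)
      = 2 * φ ‖r - r₀‖ + φ' / ‖r - r₀‖ * (‖r - r₀‖ ^ 2 - w0 p r₀ ^ 2) := by
  simp only [fderiv_inner_mul_norm_sub_apply _ hne hφ]
  have h := inner_eq_sum_frame hp (r - r₀) (r - r₀)
  rw [inner_wHat_sub_of_mem hp r₀ hr, real_inner_self_eq_norm_sq] at h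
  rw [h, Fin.sum_univ_two]
  simp only [axis, Matrix.cons_val_zero, Matrix.cons_val_one, real_inner_self_eq_norm_sq,
    norm_uHat hp, norm_vHat hp]
  ring

lemma normalFlux_apply {p : Fin 3 → E3} (hp : AffineIndependent ℝ p) (q : E3) {r₀ r : E3}
    (hr : r ∈ triangle p) (hne : r ≠ r₀) :
    normalFlux p q r₀ r = ⟪wHat p, q⟫ * (‖r - r₀‖ ^ 3)⁻¹
      + (⟪tangential p q, r - r₀⟫ + ⟪wHat p, q⟫ * w0 p r₀) * (-3 / ‖r - r₀‖ ^ 5 * w0 p r₀) := by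
  have hn : 0 < ‖r - r₀‖ := norm_pos_iff.2 (sub_ne_zero.2 hne)
  rw [normalFlux_eq_fderiv, fderiv_inner_mul_norm_sub_apply q hne (hasDerivAt_inv_cube hn),
    inner_wHat_sub_of_mem hp r₀ hr, real_inner_comm]
  have : ⟪q, r - r₀⟫ = ⟪tangential p q, r - r₀⟫ + ⟪wHat p, q⟫ * w0 p r₀ := by
    conv_lhs => rw [eq_tangential_add hp q]
    rw [inner_add_left, inner_smul_left, inner_wHat_sub_of_mem hp r₀ hr]
    simp
  rw [this]
  field_simp

/-- The two terms come from the tangential part of `q`, where `∂_w(1/R) = -w₀R⁻³` is differentiated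
along `q`, and from the normal part, where `-∂_w²(1/R)` equals the tangential Laplacian of `1/R`.
The identity is checked by differentiating both sides. -/
lemma normalFlux_eq_divergence {p : Fin 3 → E3} (hp : AffineIndependent ℝ p) (q : E3)
    {r₀ r : E3} (hr : r ∈ triangle p) (hne : r ≠ r₀) :
    normalFlux p q r₀ r
      = w0 p r₀ * fderiv ℝ (fun r => (‖r - r₀‖ ^ 3)⁻¹) r (tangential p q)
        - ⟪wHat p, q⟫
          * ∑ k, fderiv ℝ (fun r => ⟪axis p k, r - r₀⟫ * (‖r - r₀‖ ^ 3)⁻¹) r (axis p k) := by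
  have hn : 0 < ‖r - r₀‖ := norm_pos_iff.2 (sub_ne_zero.2 hne)
  rw [sum_fderiv_axis hp hr hne (hasDerivAt_inv_cube hn),
    fderiv_norm_sub_apply hne (hasDerivAt_inv_cube hn), normalFlux_apply hp q hr hne]
  field_simp
  ring

/-- For tangential `q`, the product rule moves the coordinate under the derivative and leaves
`-w₀R⁻³` times `q·û` or `q·v̂`. For normal `q`, the density times the coordinate is a combination of
the gradients of `R⁻³` and `R⁻¹`. -/
lemma coordA_mul_normalFlux_eq_divergence {p : Fin 3 → E3} (hp : AffineIndependent ℝ p) (q : E3)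
    {r₀ r : E3} (hr : r ∈ triangle p) (hne : r ≠ r₀) (k : Fin 2) :
    coordA p r₀ k r * normalFlux p q r₀ r
      = ⟪wHat p, q⟫ * (w0 p r₀ ^ 2 * fderiv ℝ (fun r => (‖r - r₀‖ ^ 3)⁻¹) r (axis p k)
          - fderiv ℝ (fun r => ‖r - r₀‖⁻¹) r (axis p k))
        + w0 p r₀ * fderiv ℝ (fun r => ⟪axis p k, r - r₀⟫ * (‖r - r₀‖ ^ 3)⁻¹) r (tangential p q)
        - ⟪q, axis p k⟫ * (w0 p r₀ * (‖r - r₀‖ ^ 3)⁻¹) := by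
  have hn : 0 < ‖r - r₀‖ := norm_pos_iff.2 (sub_ne_zero.2 hne)
  rw [fderiv_inner_mul_norm_sub_apply _ hne (hasDerivAt_inv_cube hn),
    fderiv_norm_sub_apply hne (hasDerivAt_inv_cube hn),
    fderiv_norm_sub_apply hne (hasDerivAt_inv hn.ne'), normalFlux_apply hp q hr hne,
    coordA_eq hp, real_inner_comm (tangential p q), tangential_inner hp q (axis_inner_wHat hp k)]
  field_simp
  ring

/-- With `h = |w₀|` and `τ² = R² - h²`, a radial field `φ R_t` has divergence `hR⁻³` when `τ²φ = C -
h/R`. The choice `C = 1` makes the right side vanish at `τ = 0` and gives `φ = 1/(R(R+h))`. -/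
lemma abs_w0_mul_inv_cube_eq_divergence {p : Fin 3 → E3} (hp : AffineIndependent ℝ p)
    {r₀ r : E3} (hr : r ∈ triangle p) (hne : r ≠ r₀) :
    |w0 p r₀| * (‖r - r₀‖ ^ 3)⁻¹
      = ∑ k, fderiv ℝ (fun r => ⟪axis p k, r - r₀⟫
          * (‖r - r₀‖ * (‖r - r₀‖ + |w0 p r₀|))⁻¹) r (axis p k) := by
  have hn : 0 < ‖r - r₀‖ := norm_pos_iff.2 (sub_ne_zero.2 hne)
  have hw := abs_nonneg (w0 p r₀)
  have : 0 < ‖r - r₀‖ + |w0 p r₀| := by positivity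
  rw [sum_fderiv_axis hp hr hne (φ := fun x => (x * (x + |w0 p r₀|))⁻¹)
    (hasDerivAt_inv_mul_add hn hw), ← sq_abs (w0 p r₀)]
  field_simp
  ring

/-! ### The closed forms -/

lemma continuousOn_inv_cube : ContinuousOn (fun x : ℝ => (x ^ 3)⁻¹) (Set.Ioi 0) := fun _ hx =>
  (contDiffAt_inv_cube hx).continuousAt.continuousWithinAt

lemma continuousOn_inv_mul_add {h : ℝ} (hh : 0 ≤ h) :
    ContinuousOn (fun x : ℝ => (x * (x + h))⁻¹) (Set.Ioi 0) := fun _ hx =>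
  (contDiffAt_inv_mul_add hx hh).continuousAt.continuousWithinAt

section

variable {p : Fin 3 → E3} {r₀ : E3}

lemma ne_of_mem_triangle (hT : r₀ ∉ triangle p) {r : E3} (hr : r ∈ triangle p) : r ≠ r₀ := by
  rintro rfl; exact hT hr

lemma norm_sub_pos_of_mem (hT : r₀ ∉ triangle p) {r : E3} (hr : r ∈ triangle p) :
    0 < ‖r - r₀‖ := norm_pos_iff.2 (sub_ne_zero.2 (ne_of_mem_triangle hT hr))

lemma contDiffAt_inv_norm_cube (hT : r₀ ∉ triangle p) :
    ∀ r ∈ triangle p, ContDiffAt ℝ 1 (fun r => (‖r - r₀‖ ^ 3)⁻¹) r := fun _ hr =>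
  contDiffAt_comp_norm_sub (φ := fun x => (x ^ 3)⁻¹) (ne_of_mem_triangle hT hr)
    (contDiffAt_inv_cube (norm_sub_pos_of_mem hT hr))

lemma contDiffAt_inv_norm (hT : r₀ ∉ triangle p) :
    ∀ r ∈ triangle p, ContDiffAt ℝ 1 (fun r => ‖r - r₀‖⁻¹) r := fun _ hr =>
  contDiffAt_comp_norm_sub (φ := fun x => x⁻¹) (ne_of_mem_triangle hT hr)
    (contDiffAt_inv ℝ (norm_sub_pos_of_mem hT hr).ne')

lemma contDiffAt_inner_mul_inv_norm_cube (hT : r₀ ∉ triangle p) (a : E3) :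
    ∀ r ∈ triangle p, ContDiffAt ℝ 1 (fun r => ⟪a, r - r₀⟫ * (‖r - r₀‖ ^ 3)⁻¹) r := fun _ hr =>
  contDiffAt_inner_mul_comp_norm_sub (φ := fun x => (x ^ 3)⁻¹) a (ne_of_mem_triangle hT hr)
    (contDiffAt_inv_cube (norm_sub_pos_of_mem hT hr))

lemma contDiffAt_inner_mul_inv_mul_add (hT : r₀ ∉ triangle p) (a : E3) {h : ℝ} (hh : 0 ≤ h) :
    ∀ r ∈ triangle p,
      ContDiffAt ℝ 1 (fun r => ⟪a, r - r₀⟫ * (‖r - r₀‖ * (‖r - r₀‖ + h))⁻¹) r := fun _ hr =>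
  contDiffAt_inner_mul_comp_norm_sub (φ := fun x => (x * (x + h))⁻¹) a (ne_of_mem_triangle hT hr)
    (contDiffAt_inv_mul_add (norm_sub_pos_of_mem hT hr) hh)

lemma integrableOn_inv_norm_cube (hT : r₀ ∉ triangle p) :
    IntegrableOn (fun r => (‖r - r₀‖ ^ 3)⁻¹) (triangle p) μHE[2] :=
  integrableOn_triangle fun r hr =>
    (contDiffAt_inv_norm_cube hT r hr).continuousAt.continuousWithinAt

lemma integrableOn_fderiv {g : E3 → ℝ} (hg : ∀ r ∈ triangle p, ContDiffAt ℝ 1 g r) (d : E3) :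
    IntegrableOn (fun r => fderiv ℝ g r d) (triangle p) μHE[2] :=
  integrableOn_triangle (continuousOn_fderiv_apply hg d)

lemma measurableSet_triangle (p : Fin 3 → E3) : MeasurableSet (triangle p) :=
  (isCompact_triangle p).measurableSet

/-- The solid angle of the triangle. -/
lemma abs_w0_mul_integral_inv_norm_cube (hp : AffineIndependent ℝ p) (hT : r₀ ∉ triangle p)
    (h0 : ∀ i, 0 < t0 p r₀ i ^ 2 + w0 p r₀ ^ 2) :
    |w0 p r₀| * ∫ r in triangle p, (‖r - r₀‖ ^ 3)⁻¹ ∂μHE[2] = beta p r₀ := by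
  have hw := abs_nonneg (w0 p r₀)
  rw [← integral_const_mul, setIntegral_congr_fun (measurableSet_triangle p) fun r hr =>
    abs_w0_mul_inv_cube_eq_divergence hp hr (ne_of_mem_triangle hT hr), integral_finsetSum]
  · simp only [integral_triangle_fderiv hp (contDiffAt_inner_mul_inv_mul_add hT _ hw)
      (axis_inner_wHat hp _)]
    rw [Finset.sum_comm, beta]
    refine Finset.sum_congr rfl fun i _ => ?_
    rw [sum_sideMean_inner_axis_mul hp (h0 i) (G := fun x => (x * (x + |w0 p r₀|))⁻¹)
      (continuousOn_inv_mul_add hw), mul_integral_inv_sqrt_mul (h0 i), R0_sq]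
    rfl
  · exact fun k _ => integrableOn_fderiv (contDiffAt_inner_mul_inv_mul_add hT _ hw) _

/-- `w₀ = sgn(w₀)|w₀|`, including `w₀ = 0`, where the convention `sgn 0 = 0` matters. -/
lemma w0_mul_integral_inv_norm_cube (hp : AffineIndependent ℝ p) (hT : r₀ ∉ triangle p)
    (h0 : ∀ i, 0 < t0 p r₀ i ^ 2 + w0 p r₀ ^ 2) :
    w0 p r₀ * ∫ r in triangle p, (‖r - r₀‖ ^ 3)⁻¹ ∂μHE[2]
      = Real.sign (w0 p r₀) * beta p r₀ := by
  rw [← abs_w0_mul_integral_inv_norm_cube hp hT h0, ← mul_assoc]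
  congr 1
  rcases lt_trichotomy (w0 p r₀) 0 with h | h | h
  · rw [Real.sign_of_neg h, abs_of_neg h]; ring
  · rw [h]; simp
  · rw [Real.sign_of_pos h, abs_of_pos h]; ring

lemma integrableOn_sum_fderiv_axis (hT : r₀ ∉ triangle p) :
    IntegrableOn (fun r => ∑ k, fderiv ℝ (fun r => ⟪axis p k, r - r₀⟫ * (‖r - r₀‖ ^ 3)⁻¹) r
      (axis p k)) (triangle p) μHE[2] :=
  integrable_finsetSum _ fun k _ =>
    integrableOn_fderiv (contDiffAt_inner_mul_inv_norm_cube hT (axis p k)) _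

theorem integrableOn_normalFlux (hp : AffineIndependent ℝ p) (q : E3) (hT : r₀ ∉ triangle p) :
    IntegrableOn (normalFlux p q r₀) (triangle p) μHE[2] :=
  IntegrableOn.congr_fun
    (((integrableOn_fderiv (contDiffAt_inv_norm_cube hT) _).const_mul _).sub
      ((integrableOn_sum_fderiv_axis hT).const_mul _))
    (fun _ hr => (normalFlux_eq_divergence hp q hr (ne_of_mem_triangle hT hr)).symm)
    (measurableSet_triangle p)

theorem integrableOn_coordA_mul_normalFlux (hp : AffineIndependent ℝ p) (q : E3)
    (hT : r₀ ∉ triangle p) (k : Fin 2) :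
    IntegrableOn (fun r => coordA p r₀ k r * normalFlux p q r₀ r) (triangle p) μHE[2] :=
  IntegrableOn.congr_fun
    ((((((integrableOn_fderiv (contDiffAt_inv_norm_cube hT) _).const_mul _).sub
      (integrableOn_fderiv (contDiffAt_inv_norm hT) _)).const_mul _).add
      ((integrableOn_fderiv (contDiffAt_inner_mul_inv_norm_cube hT _) _).const_mul _)).sub
      (((integrableOn_inv_norm_cube hT).const_mul _).const_mul _))
    (fun _ hr => (coordA_mul_normalFlux_eq_divergence hp q hr (ne_of_mem_triangle hT hr) k).symm)
    (measurableSet_triangle p)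

theorem I0_eq (hp : AffineIndependent ℝ p) (q : E3) (hT : r₀ ∉ triangle p)
    (h0 : ∀ i, 0 < t0 p r₀ i ^ 2 + w0 p r₀ ^ 2) :
    I0 p q r₀ = ⟪q, ∑ i, Rs p r₀ i • (w0 p r₀ • mHat p i - t0 p r₀ i • wHat p)⟫ := by
  have hi := fun k => integrableOn_fderiv (contDiffAt_inner_mul_inv_norm_cube hT (axis p k))
    (axis p k)
  rw [I0, setIntegral_congr_fun (measurableSet_triangle p) fun r hr =>
    normalFlux_eq_divergence hp q hr (ne_of_mem_triangle hT hr), integral_sub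
    ((integrableOn_fderiv (contDiffAt_inv_norm_cube hT) _).const_mul _)
    ((integrableOn_sum_fderiv_axis hT).const_mul _), integral_const_mul, integral_const_mul,
    integral_finsetSum _ fun k _ => hi k,
    integral_triangle_fderiv hp (contDiffAt_inv_norm_cube hT) (tangential_inner_wHat hp q)]
  simp only [integral_triangle_fderiv hp (contDiffAt_inner_mul_inv_norm_cube hT _)
    (axis_inner_wHat hp _)]
  rw [Finset.sum_comm, inner_sum, Finset.mul_sum, Finset.mul_sum, ← Finset.sum_sub_distrib]
  refine Finset.sum_congr rfl fun i _ => ?_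
  rw [sum_sideMean_inner_axis_mul hp (h0 i) continuousOn_inv_cube,
    ← sideMean_norm hp r₀ i fun x => (x ^ 3)⁻¹, sideMean_inv_norm_cube hp (h0 i),
    tangential_inner hp q (inner_mHat_wHat p i), inner_smul_right, inner_sub_right,
    inner_smul_right, inner_smul_right, real_inner_comm q (wHat p)]
  ring

/-- The gradients of `R⁻³` and `R⁻¹` give the `ŵ` term, the derivative along the tangential part of
`q` gives the `m̂_i` term, and the solid angle gives the term in `β`. -/
theorem Ia_eq (hp : AffineIndependent ℝ p) (q : E3) (hT : r₀ ∉ triangle p)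
    (h0 : ∀ i, 0 < t0 p r₀ i ^ 2 + w0 p r₀ ^ 2) (k : Fin 2) :
    Ia p q r₀ k = ⟪q,
        w0 p r₀ • ∑ i, ⟪axis p k, Rd p r₀ i • sHat p i + Rs p r₀ i • (t0 p r₀ i • mHat p i)⟫
            • mHat p i
        - (Real.sign (w0 p r₀) * beta p r₀) • axis p k
        + ⟪axis p k, ∑ i, (Rs p r₀ i * w0 p r₀ ^ 2 - f2 p r₀ i) • mHat p i⟫ • wHat p⟫ := by
  have hk := axis_inner_wHat hp k
  have i1 := (integrableOn_fderiv (contDiffAt_inv_norm_cube hT) (axis p k)).const_mul (w0 p r₀ ^ 2)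
  have i2 := integrableOn_fderiv (contDiffAt_inv_norm hT) (axis p k)
  have i12 : IntegrableOn (fun r => w0 p r₀ ^ 2 * fderiv ℝ (fun r => (‖r - r₀‖ ^ 3)⁻¹) r (axis p k)
      - fderiv ℝ (fun r => ‖r - r₀‖⁻¹) r (axis p k)) (triangle p) μHE[2] := i1.sub i2
  have i3 := (integrableOn_fderiv (contDiffAt_inner_mul_inv_norm_cube hT (axis p k))
    (tangential p q)).const_mul (w0 p r₀)
  have i4 := ((integrableOn_inv_norm_cube hT).const_mul (w0 p r₀)).const_mul ⟪q, axis p k⟫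
  rw [Ia, setIntegral_congr_fun (measurableSet_triangle p) fun r hr =>
    coordA_mul_normalFlux_eq_divergence hp q hr (ne_of_mem_triangle hT hr) k,
    integral_sub ((i12.const_mul _).fun_add i3) i4,
    integral_add (i12.const_mul _) i3,
    integral_const_mul, integral_sub i1 i2, integral_const_mul, integral_const_mul,
    integral_const_mul, integral_const_mul, w0_mul_integral_inv_norm_cube hp hT h0,
    integral_triangle_fderiv hp (contDiffAt_inv_norm_cube hT) hk,
    integral_triangle_fderiv hp (contDiffAt_inv_norm hT) hk,
    integral_triangle_fderiv hp (contDiffAt_inner_mul_inv_norm_cube hT _)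
      (tangential_inner_wHat hp q)]
  simp only [sideMean_inv_norm_cube hp (h0 _), sideMean_inv_norm hp (h0 _),
    sideMean_inner_mul_inv_norm_cube hp (h0 _) hk, tangential_inner hp q (inner_mHat_wHat p _)]
  simp only [Fin.sum_univ_three, inner_add_right, inner_sub_right, inner_smul_right,
    real_inner_comm q (wHat p)]
  ring

end

/-! ### Linear basis functions -/

/-- `m̂₃ = -v̂`, hence `s₃v₃ = |areaVec|`: base times height is twice the area. -/
lemma v3_pos {p : Fin 3 → E3} (hp : AffineIndependent ℝ p) : 0 < v3 p := by
  have h := sideLen_mul_inner_mHat hp 2 (p 2 - p 0)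
  rw [side_two, cross_antisymm, ← areaVec, inner_neg_right, inner_wHat_areaVec hp] at h
  have hm : mHat p 2 = -vHat p := by rw [vHat, cross_antisymm, neg_neg]; rfl
  have hv : v3 p = ⟪p 2 - p 0, vHat p⟫ := by
    rw [v3, side_one, ← inner_neg_left, neg_sub]
  rw [hm, inner_neg_right, ← hv] at h
  have h1 := norm_pos_iff.2 (areaVec_ne_zero hp)
  have h2 := sideLen_pos hp 2
  by_contra hn
  nlinarith

lemma node_one_eq {p : Fin 3 → E3} (hp : AffineIndependent ℝ p) :
    p 1 = p 0 + sideLen p 2 • uHat p := by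
  rw [uHat, sideLen_smul_sHat hp, side_two]; abel

lemma node_two_eq {p : Fin 3 → E3} (hp : AffineIndependent ℝ p) :
    p 2 = p 0 + (u3 p • uHat p + v3 p • vHat p) := by
  have h := eq_sum_frame hp (p 2 - p 0)
  rw [real_inner_comm _ (wHat p), inner_sub_wHat hp, zero_smul, add_zero,
    real_inner_comm _ (uHat p), real_inner_comm _ (vHat p)] at h
  rw [u3, v3, ← inner_neg_left, ← inner_neg_left, side_one, neg_sub, ← h]
  abel

/-- An affine function on the triangle in the local coordinates. -/
lemma affine_apply_of_mem {p : Fin 3 → E3} (hp : AffineIndependent ℝ p) (r₀ : E3)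
    (φ : E3 →ᵃ[ℝ] ℝ) {r : E3} (hr : r ∈ triangle p) :
    φ r = φ (p 0) + (φ (p 1) - φ (p 0)) * (sideLen p 2)⁻¹ * (u0 p r₀ + coordA p r₀ 0 r)
      + ((φ (p 2) - φ (p 0)) - u3 p * ((φ (p 1) - φ (p 0)) * (sideLen p 2)⁻¹)) * (v3 p)⁻¹
        * (v0 p r₀ + coordA p r₀ 1 r) := by
  have hadd : ∀ x : E3, φ (p 0 + x) = φ (p 0) + φ.linear x := fun x => by
    rw [add_comm (p 0), ← vadd_eq_add, φ.map_vadd, vadd_eq_add, add_comm]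
  have h1 := hadd (sideLen p 2 • uHat p)
  have h2 := hadd (u3 p • uHat p + v3 p • vHat p)
  rw [← node_one_eq hp, map_smul, smul_eq_mul] at h1
  rw [← node_two_eq hp, map_add, map_smul, map_smul, smul_eq_mul, smul_eq_mul] at h2
  have hs := (sideLen_pos hp 2).ne'
  have hv := (v3_pos hp).ne'
  -- The values at `p 1` and `p 2` form a triangular system for the slopes along `û` and `v̂`, since
  -- `p 1 - p 0` has no `v̂` component. Solving it produces the entries of `basisMatrix`.
  have hu : φ.linear (uHat p) = (φ (p 1) - φ (p 0)) * (sideLen p 2)⁻¹ := by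
    rw [h1]; field_simp; ring
  have hv' : φ.linear (vHat p) = ((φ (p 2) - φ (p 0)) - u3 p * φ.linear (uHat p)) * (v3 p)⁻¹ := by
    rw [h2]; field_simp; ring
  have hc0 : u0 p r₀ + coordA p r₀ 0 r = ⟪uHat p, r - p 0⟫ := by
    rw [coordA_eq hp, u0, real_inner_comm]
    simp only [axis, Matrix.cons_val_zero]
    rw [← inner_add_right]; congr 1; abel
  have hc1 : v0 p r₀ + coordA p r₀ 1 r = ⟪vHat p, r - p 0⟫ := by
    rw [coordA_eq hp, v0, real_inner_comm]
    simp only [axis, Matrix.cons_val]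
    rw [← inner_add_right]; congr 1; abel
  have hr' := eq_sum_frame hp (r - p 0)
  rw [real_inner_comm _ (wHat p), inner_sub_wHat_of_mem hp hr, zero_smul, add_zero, ← hc0,
    ← hc1] at hr'
  have h3 := hadd (r - p 0)
  rw [add_sub_cancel, hr', map_add, map_smul, map_smul, smul_eq_mul, smul_eq_mul, hv', hu] at h3
  rw [h3]
  ring

lemma four_pi_smul_bs {p : Fin 3 → E3} (q r₀ : E3) (φ : Fin 3 → E3 → ℝ) (i : Fin 3) :
    4 * Real.pi * bs p q r₀ φ i = ∫ r in triangle p, φ i r * normalFlux p q r₀ r ∂μHE[2] := by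
  have := Real.pi_ne_zero
  rw [bs]
  field_simp

/-- The moments of an affine function against the flux density. -/
lemma affine_moment {p : Fin 3 → E3} (hp : AffineIndependent ℝ p) {r₀ : E3} (q : E3)
    (hT : r₀ ∉ triangle p) {f : E3 → ℝ} {a b c : ℝ}
    (hf : ∀ r ∈ triangle p,
      f r = a + b * (u0 p r₀ + coordA p r₀ 0 r) + c * (v0 p r₀ + coordA p r₀ 1 r)) :
    IntegrableOn (fun r => f r * normalFlux p q r₀ r) (triangle p) μHE[2] ∧
    ∫ r in triangle p, f r * normalFlux p q r₀ r ∂μHE[2]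
      = I0 p q r₀ * (a + b * u0 p r₀ + c * v0 p r₀) + (b * Ia p q r₀ 0 + c * Ia p q r₀ 1) := by
  have i0 := (integrableOn_normalFlux hp q hT).const_mul (a + b * u0 p r₀ + c * v0 p r₀)
  have i1 := (integrableOn_coordA_mul_normalFlux hp q hT 0).const_mul b
  have i2 := (integrableOn_coordA_mul_normalFlux hp q hT 1).const_mul c
  have he : Set.EqOn (fun r => (a + b * u0 p r₀ + c * v0 p r₀) * normalFlux p q r₀ r
      + (b * (coordA p r₀ 0 r * normalFlux p q r₀ r)
        + c * (coordA p r₀ 1 r * normalFlux p q r₀ r)))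
      (fun r => f r * normalFlux p q r₀ r) (triangle p) := fun r hr => by
    simp only [hf r hr]; ring
  refine ⟨IntegrableOn.congr_fun (i0.add (i1.add i2)) he (measurableSet_triangle p), ?_⟩
  rw [← setIntegral_congr_fun (measurableSet_triangle p) he, integral_add i0 (i1.fun_add i2),
    integral_add i1 i2, integral_const_mul, integral_const_mul, integral_const_mul, I0, Ia, Ia]
  ring

end SurfaceElement

/-! ### Assembly of the closed forms and the source vector -/

theorem mainTheorem2
    (p : Fin 3 → SurfaceElement.E3) (q r₀ : SurfaceElement.E3)
    (hp : AffineIndependent ℝ p)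
    (hT : r₀ ∉ SurfaceElement.triangle p)
    (hline : ∀ i : Fin 3, r₀ ∉ line[ℝ, p (i - 1), p (i + 1)]) :
    -- the integrals converge
    IntegrableOn (SurfaceElement.normalFlux p q r₀) (SurfaceElement.triangle p) μHE[2] ∧
    (∀ k : Fin 2, IntegrableOn
      (fun r => SurfaceElement.coordA p r₀ k r * SurfaceElement.normalFlux p q r₀ r)
      (SurfaceElement.triangle p) μHE[2]) ∧
    -- the closed form of the first moments
    (∀ k : Fin 2, SurfaceElement.Ia p q r₀ k =
      ⟪q,
        SurfaceElement.w0 p r₀ • ∑ i : Fin 3,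
          ⟪SurfaceElement.axis p k,
            SurfaceElement.Rd p r₀ i • SurfaceElement.sHat p i
              + SurfaceElement.Rs p r₀ i • (SurfaceElement.t0 p r₀ i • SurfaceElement.mHat p i)⟫
            • SurfaceElement.mHat p i
        - (Real.sign (SurfaceElement.w0 p r₀) * SurfaceElement.beta p r₀)
            • SurfaceElement.axis p k
        + ⟪SurfaceElement.axis p k,
            ∑ i : Fin 3, (SurfaceElement.Rs p r₀ i * SurfaceElement.w0 p r₀ ^ 2
              - SurfaceElement.f2 p r₀ i) • SurfaceElement.mHat p i⟫
            • SurfaceElement.wHat p⟫) ∧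
    -- the closed form of `I₀`
    SurfaceElement.I0 p q r₀ =
      ⟪q, ∑ i : Fin 3, SurfaceElement.Rs p r₀ i •
        (SurfaceElement.w0 p r₀ • SurfaceElement.mHat p i
          - SurfaceElement.t0 p r₀ i • SurfaceElement.wHat p)⟫ ∧
    -- the surface element source vector of the linear basis functions
    (∀ φ : Fin 3 → SurfaceElement.E3 →ᵃ[ℝ] ℝ,
      (∀ i j : Fin 3, φ i (p j) = if i = j then 1 else 0) →
      (∀ i : Fin 3, IntegrableOn (fun r => φ i r * SurfaceElement.normalFlux p q r₀ r)
        (SurfaceElement.triangle p) μHE[2]) ∧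
      (4 * Real.pi) • SurfaceElement.bs p q r₀ (fun i => φ i) =
        SurfaceElement.I0 p q r₀ • (SurfaceElement.basisMatrix p
          *ᵥ ![1, SurfaceElement.u0 p r₀, SurfaceElement.v0 p r₀])
        + SurfaceElement.basisMatrixLin p *ᵥ SurfaceElement.Ia p q r₀) := by
  have h0 : ∀ i, 0 < SurfaceElement.t0 p r₀ i ^ 2 + SurfaceElement.w0 p r₀ ^ 2 := fun i =>
    SurfaceElement.R0_sq_pos hp (hline i)
  refine ⟨SurfaceElement.integrableOn_normalFlux hp q hT,
    SurfaceElement.integrableOn_coordA_mul_normalFlux hp q hT,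
    SurfaceElement.Ia_eq hp q hT h0, SurfaceElement.I0_eq hp q hT h0, fun φ hφ => ?_⟩
  have key := fun i => SurfaceElement.affine_moment hp q hT
    fun r hr => SurfaceElement.affine_apply_of_mem hp r₀ (φ i) hr
  refine ⟨fun i => (key i).1, ?_⟩
  ext i
  rw [Pi.smul_apply, smul_eq_mul, SurfaceElement.four_pi_smul_bs, (key i).2]
  -- Inserting the nodal values `δ_ij` into the coefficients of the affine formula gives the rows of
  -- the two matrices, one for each `i`.
  simp only [hφ]
  fin_cases i <;>
    simp [SurfaceElement.basisMatrix, SurfaceElement.basisMatrixLin, dotProduct,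
      Fin.sum_univ_two] <;>
    first | ring1 | (left; ring1)
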